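/- Let $M$ be a (Hausdorff) smooth manifold of dimension $2$ with a symplectic form $\omega$, and let $\nabla$ be a symplectic connection on $(M,\omega)$, i.e. a smooth torsion-free affine connection with $\nabla\omega=0$. Let $R(X,Y)Z=\nabla_X\nabla_YZ-\nabla_Y\nabla_XZ-\nabla_{[X,Y]}Z$ be its curvature and $r(Y,Z)=\operatorname{tr}\big(V\mapsto R(Y,V)Z\big)$ its Ricci curvature. Assume that (a) $\nabla$ is preferred: $(\nabla_Xr)(Y,Z)+(\nabla_Yr)(Z,X)+(\nabla_Zr)(X,Y)=0$ for all vector fields $X,Y,Z$; (b) $\nabla$ is analytic: around every point of $M$ there is a smooth chart in which the Christoffel symbols of $\nabla$ are real analytic functions of the coordinates. Then $\nabla$ is of type S: for every $p\in M$ there is an open star-shaped neighbourhood $V=-V$ of $0$ in $T_pM$, contained in the domain of the exponential map $\exp_p$ of $\nabla$ and mapped by $\exp_p$ diffeomorphically onto an open neighbourhood $U$ of $p$, such that the local geodesic symmetry $s_p:U\to U$, $s_p(\exp_p(v))=\exp_p(-v)$ for $v\in V$, satisfies $s_p^*(\omega|_U)=\omega|_U$. -/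

import Mathlib

open scoped Manifold ContDiff

noncomputable section

namespace Fedosov

variable {n : ℕ} {M : Type*} [TopologicalSpace M] [ChartedSpace (EuclideanSpace ℝ (Fin n)) M]
  [IsManifold (𝓡 n) ∞ M]

/-- Affine connections on an `n`-dimensional manifold, i.e. covariant derivatives on its tangent
bundle. For a connection `D`, the vector `D Y x u` is `∇_u Y` at the point `x`. -/
abbrev AffineConnection (n : ℕ) (M : Type*) [TopologicalSpace M]
    [ChartedSpace (EuclideanSpace ℝ (Fin n)) M] [IsManifold (𝓡 n) ∞ M] :=
  CovariantDerivative (𝓡 n) (EuclideanSpace ℝ (Fin n)) (TangentSpace (𝓡 n) : M → Type _)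

/-- The vector field `∇_X Y`. -/
def nabla (D : AffineConnection n M) (X Y : Π x : M, TangentSpace (𝓡 n) x) :
    Π x : M, TangentSpace (𝓡 n) x :=
  fun x ↦ D Y x (X x)

/-- Smoothness of a (local) vector field on a set. -/
def IsSmoothFieldOn (X : Π x : M, TangentSpace (𝓡 n) x) (U : Set M) :
    Prop :=
  ContMDiffOn (𝓡 n) (𝓡 n).tangent ∞ (fun x ↦ (⟨x, X x⟩ : TangentBundle (𝓡 n) M)) U

/-! ### Symplectic forms and symplectic connections -/

/-- `Ω` is a symplectic form: a smooth, alternating, nondegenerate and closed field of bilinear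
forms. Closedness is the vanishing of
`dΩ(X,Y,Z) = X Ω(Y,Z) + Y Ω(Z,X) + Z Ω(X,Y) - Ω([X,Y],Z) - Ω([Y,Z],X) - Ω([Z,X],Y)`. -/
structure IsSymplecticForm
    (Ω : Π x : M, TangentSpace (𝓡 n) x →L[ℝ] TangentSpace (𝓡 n) x →L[ℝ] ℝ) : Prop where
  smooth : ContMDiff (𝓡 n)
    ((𝓡 n).prod 𝓘(ℝ, EuclideanSpace ℝ (Fin n) →L[ℝ] EuclideanSpace ℝ (Fin n) →L[ℝ] ℝ)) ∞
    (fun x ↦ Bundle.TotalSpace.mk'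
      (EuclideanSpace ℝ (Fin n) →L[ℝ] EuclideanSpace ℝ (Fin n) →L[ℝ] ℝ) x (Ω x))
  alternating : ∀ (x : M) (u : TangentSpace (𝓡 n) x), Ω x u u = 0
  nondegenerate : ∀ (x : M) (u : TangentSpace (𝓡 n) x), (∀ v, Ω x u v = 0) → u = 0
  closed : ∀ (U : Set M), IsOpen U → ∀ X Y Z : Π x : M, TangentSpace (𝓡 n) x,
    IsSmoothFieldOn X U → IsSmoothFieldOn Y U → IsSmoothFieldOn Z U → ∀ x ∈ U,
      mvfderiv (𝓡 n) (fun y ↦ Ω y (Y y) (Z y)) x (X x)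
        + mvfderiv (𝓡 n) (fun y ↦ Ω y (Z y) (X y)) x (Y x)
        + mvfderiv (𝓡 n) (fun y ↦ Ω y (X y) (Y y)) x (Z x)
        - Ω x (VectorField.mlieBracket (𝓡 n) X Y x) (Z x)
        - Ω x (VectorField.mlieBracket (𝓡 n) Y Z x) (X x)
        - Ω x (VectorField.mlieBracket (𝓡 n) Z X x) (Y x) = 0

/-- The torsion `∇_X Y - ∇_Y X - [X,Y]` vanishes. -/
def IsTorsionFree (D : AffineConnection n M) : Prop :=
  ∀ (U : Set M), IsOpen U → ∀ X Y : Π x : M, TangentSpace (𝓡 n) x,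
    IsSmoothFieldOn X U → IsSmoothFieldOn Y U → ∀ x ∈ U,
      nabla D X Y x - nabla D Y X x = VectorField.mlieBracket (𝓡 n) X Y x

/-- A symplectic connection: a smooth torsion-free affine connection with `∇Ω = 0`, i.e.
`X Ω(Y,Z) = Ω(∇_X Y, Z) + Ω(Y, ∇_X Z)`. -/
structure IsSymplecticConnection
    (Ω : Π x : M, TangentSpace (𝓡 n) x →L[ℝ] TangentSpace (𝓡 n) x →L[ℝ] ℝ)
    (D : AffineConnection n M) : Prop where
  smooth : ∀ (U : Set M), IsOpen U → ∀ X Y : Π x : M, TangentSpace (𝓡 n) x,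
    IsSmoothFieldOn X U → IsSmoothFieldOn Y U → IsSmoothFieldOn (nabla D X Y) U
  torsionFree : IsTorsionFree D
  parallel : ∀ (U : Set M), IsOpen U → ∀ X Y Z : Π x : M, TangentSpace (𝓡 n) x,
    IsSmoothFieldOn X U → IsSmoothFieldOn Y U → IsSmoothFieldOn Z U → ∀ x ∈ U,
      mvfderiv (𝓡 n) (fun y ↦ Ω y (Y y) (Z y)) x (X x)
        = Ω x (nabla D X Y x) (Z x) + Ω x (Y x) (nabla D X Z x)

/-! ### Coordinates and Christoffel symbols -/

/-- The coordinate vector field `∑ i, u i • ∂ᵢ` of the chart `e`, with constant components `u`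
(meaningful on the domain of `e`). -/
def coordField (e : OpenPartialHomeomorph M (EuclideanSpace ℝ (Fin n)))
    (u : EuclideanSpace ℝ (Fin n)) : Π x : M, TangentSpace (𝓡 n) x :=
  fun x ↦ (mfderiv (𝓡 n) 𝓘(ℝ, EuclideanSpace ℝ (Fin n)) e x).inverse u

/-- The components in the chart `e` of a tangent vector at `x`. -/
def components (e : OpenPartialHomeomorph M (EuclideanSpace ℝ (Fin n))) (x : M)
    (v : TangentSpace (𝓡 n) x) : EuclideanSpace ℝ (Fin n) :=
  mfderiv (𝓡 n) 𝓘(ℝ, EuclideanSpace ℝ (Fin n)) e x v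

/-- The Christoffel symbols of `D` in the chart `e`, as a function of the coordinates `y`:
`christoffel D e y u v k = ∑ i j, Γᵏᵢⱼ(y) * u i * v j`, where `∇_{∂ᵢ} ∂ⱼ = ∑ k, Γᵏᵢⱼ ∂ₖ`. -/
def christoffel (D : AffineConnection n M)
    (e : OpenPartialHomeomorph M (EuclideanSpace ℝ (Fin n)))
    (y u v : EuclideanSpace ℝ (Fin n)) : EuclideanSpace ℝ (Fin n) :=
  components e (e.symm y) (nabla D (coordField e u) (coordField e v) (e.symm y))

/-- `D` is (real) analytic: around every point there is a chart of the smooth structure in which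
the Christoffel symbols are real analytic functions of the coordinates. -/
def IsAnalyticConnection (D : AffineConnection n M) : Prop :=
  ∀ p : M, ∃ e ∈ IsManifold.maximalAtlas (𝓡 n) ∞ M, p ∈ e.source ∧
    ∀ u v : EuclideanSpace ℝ (Fin n), AnalyticOnNhd ℝ (fun y ↦ christoffel D e y u v) e.target

/-! ### Curvature and preferred connections -/

/-- The curvature `R(X,Y)Z = ∇_X ∇_Y Z - ∇_Y ∇_X Z - ∇_[X,Y] Z`. -/
def curvature (D : AffineConnection n M) (X Y Z : Π x : M, TangentSpace (𝓡 n) x) :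
    Π x : M, TangentSpace (𝓡 n) x :=
  fun x ↦ nabla D X (nabla D Y Z) x - nabla D Y (nabla D X Z) x
    - nabla D (VectorField.mlieBracket (𝓡 n) X Y) Z x

/-- The Ricci curvature `r(Y,Z) = tr (V ↦ R(Y,V)Z)` on the domain of the chart `e`, the trace being
computed in the coordinate frame `∂ᵢ` of `e`. -/
def ricci (D : AffineConnection n M) (e : OpenPartialHomeomorph M (EuclideanSpace ℝ (Fin n)))
    (Y Z : Π x : M, TangentSpace (𝓡 n) x) (x : M) : ℝ :=
  ∑ i : Fin n, components e x (curvature D Y (coordField e (EuclideanSpace.single i 1)) Z x) i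

/-- `(∇_X r)(Y,Z) = X r(Y,Z) - r(∇_X Y, Z) - r(Y, ∇_X Z)` on the domain of the chart `e`. -/
def nablaRicci (D : AffineConnection n M)
    (e : OpenPartialHomeomorph M (EuclideanSpace ℝ (Fin n)))
    (X Y Z : Π x : M, TangentSpace (𝓡 n) x) (x : M) : ℝ :=
  mvfderiv (𝓡 n) (ricci D e Y Z) x (X x) - ricci D e (nabla D X Y) Z x
    - ricci D e Y (nabla D X Z) x

/-- A preferred connection: a symplectic connection whose Ricci curvature is cyclic parallel,
`(∇_X r)(Y,Z) + (∇_Y r)(Z,X) + (∇_Z r)(X,Y) = 0`. -/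
structure IsPreferred
    (Ω : Π x : M, TangentSpace (𝓡 n) x →L[ℝ] TangentSpace (𝓡 n) x →L[ℝ] ℝ)
    (D : AffineConnection n M) : Prop extends IsSymplecticConnection Ω D where
  cyclic : ∀ e ∈ IsManifold.maximalAtlas (𝓡 n) ∞ M, ∀ X Y Z : Π x : M, TangentSpace (𝓡 n) x,
    IsSmoothFieldOn X e.source → IsSmoothFieldOn Y e.source → IsSmoothFieldOn Z e.source →
      ∀ x ∈ e.source,
        nablaRicci D e X Y Z x + nablaRicci D e Y Z X x + nablaRicci D e Z X Y x = 0

/-! ### Geodesics, exponential map, geodesic symmetries -/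

/-- `γ` restricted to `J` is a geodesic: it is smooth and satisfies
`c'' + Γ(c)(c', c') = 0` for its expression `c = e ∘ γ` in every chart `e`. -/
structure IsGeodesicOn (D : AffineConnection n M) (γ : ℝ → M) (J : Set ℝ) : Prop where
  smooth : ContMDiffOn 𝓘(ℝ, ℝ) (𝓡 n) ∞ γ J
  equation : ∀ e ∈ IsManifold.maximalAtlas (𝓡 n) ∞ M, ∀ t ∈ J, γ t ∈ e.source →
    deriv (deriv (e ∘ γ)) t
      + christoffel D e (e (γ t)) (deriv (e ∘ γ) t) (deriv (e ∘ γ) t) = 0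

/-- `γ` is a geodesic on an open interval containing `[0,1]` with `γ 0 = p` and `γ' 0 = v`. -/
def IsGeodesicFrom (D : AffineConnection n M) (p : M) (v : TangentSpace (𝓡 n) p) (γ : ℝ → M) :
    Prop :=
  (∃ ε > 0, IsGeodesicOn D γ (Set.Ioo (-ε) (1 + ε))) ∧
    tangentMap 𝓘(ℝ, ℝ) (𝓡 n) γ ⟨0, (1 : ℝ)⟩ = (⟨p, v⟩ : TangentBundle (𝓡 n) M)

/-- The domain of the exponential map at `p`. -/
def expDomain (D : AffineConnection n M) (p : M) : Set (TangentSpace (𝓡 n) p) :=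
  {v | ∃ γ : ℝ → M, IsGeodesicFrom D p v γ}

open Classical in
/-- The exponential map at `p`: the value at time `1` of the geodesic with initial velocity `v`
(and the irrelevant value `p` outside of `expDomain D p`). -/
def expMap (D : AffineConnection n M) (p : M) (v : TangentSpace (𝓡 n) p) : M :=
  if h : ∃ γ : ℝ → M, IsGeodesicFrom D p v γ then h.choose 1 else p

/-- `Φ` is the exponential map at `p` restricted to a star-shaped neighbourhood `Φ.source` of `0`,
symmetric under `v ↦ -v`, which it maps diffeomorphically onto the open set `Φ.target`;
thus `Φ.target` is a symmetric normal neighbourhood of `p`. -/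
structure IsSymmetricNormal (D : AffineConnection n M) (p : M)
    (Φ : PartialDiffeomorph 𝓘(ℝ, EuclideanSpace ℝ (Fin n)) (𝓡 n)
      (EuclideanSpace ℝ (Fin n)) M ∞) : Prop where
  zero_mem : (0 : EuclideanSpace ℝ (Fin n)) ∈ Φ.source
  starConvex : StarConvex ℝ (0 : EuclideanSpace ℝ (Fin n)) Φ.source
  neg_mem : ∀ v ∈ Φ.source, -v ∈ Φ.source
  subset_expDomain : ∀ v ∈ Φ.source, v ∈ expDomain D p
  eq_expMap : ∀ v ∈ Φ.source, Φ v = expMap D p v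

/-- The geodesic symmetry `exp_p v ↦ exp_p (-v)` on the symmetric normal neighbourhood
`Φ.target`. -/
def geodesicSymmetry
    (Φ : PartialDiffeomorph 𝓘(ℝ, EuclideanSpace ℝ (Fin n)) (𝓡 n)
      (EuclideanSpace ℝ (Fin n)) M ∞) (x : M) : M :=
  Φ (-(Φ.symm x))

/-- `D` is of type S: it is torsion-free, and every point `p` has a symmetric normal neighbourhood
on which the geodesic symmetry `s` at `p` satisfies `s^* Ω = Ω`. -/
def IsTypeS
    (Ω : Π x : M, TangentSpace (𝓡 n) x →L[ℝ] TangentSpace (𝓡 n) x →L[ℝ] ℝ)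
    (D : AffineConnection n M) : Prop :=
  IsTorsionFree D ∧
  ∀ p : M, ∃ Φ : PartialDiffeomorph 𝓘(ℝ, EuclideanSpace ℝ (Fin n)) (𝓡 n)
      (EuclideanSpace ℝ (Fin n)) M ∞,
    IsSymmetricNormal D p Φ ∧
    ∀ x ∈ Φ.target, ∀ u v : TangentSpace (𝓡 n) x,
      Ω (geodesicSymmetry Φ x) (mfderiv (𝓡 n) (𝓡 n) (geodesicSymmetry Φ) x u)
        (mfderiv (𝓡 n) (𝓡 n) (geodesicSymmetry Φ) x v) = Ω x u v

end Fedosov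

end

/-! On a surface the curvature is alternating in its first two arguments, so in a chart R(X,Y)Z =
σ(X,Y) A Z, where σ is the standard area form and A = R(∂₀,∂₁); hence r(Y,Z) = σ(Y, AZ). Putting X =
Y = Z in the cyclic condition gives (∇_X r)(X,X) = 0, so q = r(c',c') is constant along each
geodesic c.

Let c(t) = exp(tv), and let J(t) = t · D exp(tv) b be the Jacobi field coming from a variation of v
in the direction b. Put h = ω(c', J). Since ∇ω = 0 and c' is parallel along c, h'' = ω(c',
R(c',J)c') = σ(c',J) ω(c', Ac'). In dimension two ω is a multiple of σ, so the right-hand side is q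
h. Thus h'' = q h with q constant and h(0) = 0, which makes h odd. Comparing t = 1 with t = -1 shows
that exp^*ω takes the same value on (v, b) at v and at -v. As b is arbitrary and the dimension is
two, exp^*ω is an even form. The geodesic symmetry is v ↦ -v in exponential coordinates, so it
preserves ω.

The core computation is `even_pullback_of_cyclic`, resting on `jacobi_equation` and
`odd_of_hasDerivAt_const_mul`. An analytic exponential map in a chart comes from
`exists_analytic_exp`: the geodesic equation, as an integral equation for the velocity in C([-1,1],
E), is solved by the analytic inverse function theorem. The remaining work ties this to the
manifold: coordinate formulas for ∇, R and r, invariance of the geodesic equation under change of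
chart, and uniqueness of geodesics (`expMap_eq`), which identifies the constructed map with
`expMap`. -/

noncomputable section

namespace Fedosov

open Set Filter Topology

/-! ### Analytic superposition operators on spaces of continuous functions. -/

section Superposition

variable {K : Type*} [TopologicalSpace K] [CompactSpace K]
  {E F : Type*} [NormedAddCommGroup E] [NormedSpace ℝ E] [NormedAddCommGroup F] [NormedSpace ℝ F]

/-- The pointwise action of a continuous multilinear map on continuous functions. -/
def pointwiseMultilinear (K : Type*) [TopologicalSpace K] [CompactSpace K] {n : ℕ}
    (m : ContinuousMultilinearMap ℝ (fun _ : Fin n ↦ E) F) :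
    ContinuousMultilinearMap ℝ (fun _ : Fin n ↦ C(K, E)) C(K, F) :=
  MultilinearMap.mkContinuous
    { toFun := fun g ↦ ⟨fun t ↦ m (fun i ↦ g i t), by fun_prop⟩
      map_update_add' := by
        intro _ g i x y
        ext t
        have h (z : C(K, E)) : (fun j ↦ Function.update g i z j t)
            = Function.update (fun j ↦ g j t) i (z t) := by
          funext j
          by_cases hj : j = i
          · subst hj; simp
          · simp [hj]
        simp [h]
      map_update_smul' := by
        intro _ g i c x
        ext t
        have h (z : C(K, E)) : (fun j ↦ Function.update g i z j t)
            = Function.update (fun j ↦ g j t) i (z t) := by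
          funext j
          by_cases hj : j = i
          · subst hj; simp
          · simp [hj]
        simp [h] }
    ‖m‖ (by
      intro g
      rw [ContinuousMap.norm_le _ (by positivity)]
      intro t
      refine (m.le_opNorm _).trans ?_
      gcongr with i
      exact (g i).norm_coe_le_norm t)

theorem norm_pointwiseMultilinear_le {n : ℕ}
    (m : ContinuousMultilinearMap ℝ (fun _ : Fin n ↦ E) F) :
    ‖pointwiseMultilinear K m‖ ≤ ‖m‖ :=
  MultilinearMap.mkContinuous_norm_le _ (norm_nonneg _) _

/-- The superposition operator `y ↦ f ∘ (x₀ + y)` of an analytic map `f` on continuous functions is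
analytic near `0`. -/
theorem exists_analytic_superposition [CompleteSpace F] {f : E → F} {x₀ : E}
    (hf : AnalyticAt ℝ f x₀) :
    ∃ r > 0, ∃ N : C(K, E) → C(K, F), AnalyticOnNhd ℝ N (Metric.ball 0 r) ∧
      ∀ y ∈ Metric.ball (0 : C(K, E)) r, ∀ t, N y t = f (x₀ + y t) := by
  obtain ⟨p, R, hp⟩ := hf
  -- In the sup norm the pointwise action does not increase the norms of the coefficients, so P
  -- converges wherever p does.
  let P : FormalMultilinearSeries ℝ C(K, E) C(K, F) := fun n ↦ pointwiseMultilinear K (p n)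
  have hrad : p.radius ≤ P.radius :=
    FormalMultilinearSeries.radius_le_of_le fun n ↦ norm_pointwiseMultilinear_le _
  have hRP : R ≤ P.radius := hp.r_le.trans hrad
  obtain ⟨r, hr0, hrR⟩ : ∃ r : ℝ, 0 < r ∧ ENNReal.ofReal r ≤ R := by
    rcases eq_or_ne R ⊤ with h | h
    · exact ⟨1, one_pos, by simp [h]⟩
    · exact ⟨R.toReal, ENNReal.toReal_pos hp.r_pos.ne' h, ENNReal.ofReal_toReal_le⟩
  have hPs := P.hasFPowerSeriesOnBall (hp.r_pos.trans_le hRP)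
  have hball : ∀ y ∈ Metric.ball (0 : C(K, E)) r, y ∈ Metric.eball (0 : C(K, E)) R := by
    intro y hy
    rw [← Metric.eball_ofReal] at hy
    exact Metric.eball_subset_eball hrR hy
  refine ⟨r, hr0, P.sum, fun y hy ↦ hPs.analyticAt_of_mem
    (Metric.eball_subset_eball hRP (hball y hy)), fun y hy t ↦ ?_⟩
  have h1 := P.hasSum (Metric.eball_subset_eball hRP (hball y hy))
  -- Evaluation at t is continuous and linear, so it passes through the sum of the series.
  have h2 := (ContinuousMap.evalCLM ℝ t : C(K, F) →L[ℝ] F).hasSum h1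
  have hyt : y t ∈ Metric.eball (0 : E) R := by
    have := hball y hy
    rw [Metric.mem_eball, edist_zero_right] at this ⊢
    refine lt_of_le_of_lt ?_ this
    rw [enorm_le_iff_norm_le]
    exact y.norm_coe_le_norm t
  exact h2.unique (hp.hasSum hyt)

end Superposition

/-! ### Primitives and time rescaling on [-1,1]. -/

section Integration

variable {E : Type*} [NormedAddCommGroup E] [NormedSpace ℝ E]

/-- The interval `[-1,1]` of times. -/
abbrev TimeInterval : Type := Set.Icc (-1 : ℝ) 1

/-- The primitive vanishing at `0` of a continuous function on `[-1,1]`. -/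
def primitive (E : Type*) [NormedAddCommGroup E] [NormedSpace ℝ E] :
    C(TimeInterval, E) →L[ℝ] C(TimeInterval, E) :=
  LinearMap.mkContinuous
    { toFun := fun z ↦ ⟨fun t ↦ ∫ s in (0 : ℝ)..t, Set.IccExtend (by norm_num) z s, by
        have : Continuous (Set.IccExtend (show (-1 : ℝ) ≤ 1 by norm_num) z) := z.continuous.Icc_extend'
        exact (intervalIntegral.continuous_primitive (fun a b ↦ this.intervalIntegrable a b) 0).comp
          continuous_subtype_val⟩
      map_add' := by
        intro x y
        ext t
        have hx : Continuous (Set.IccExtend (show (-1 : ℝ) ≤ 1 by norm_num) x) :=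
          x.continuous.Icc_extend'
        have hy : Continuous (Set.IccExtend (show (-1 : ℝ) ≤ 1 by norm_num) y) :=
          y.continuous.Icc_extend'
        simpa [Set.IccExtend] using intervalIntegral.integral_add
          (hx.intervalIntegrable 0 t) (hy.intervalIntegrable 0 t)
      map_smul' := by
        intro c x
        ext t
        simp [Set.IccExtend] }
    1 (by
      intro z
      rw [ContinuousMap.norm_le _ (by positivity)]
      intro t
      have := intervalIntegral.norm_integral_le_of_norm_le_const (a := 0) (b := (t : ℝ))
        (C := ‖z‖) (f := Set.IccExtend (show (-1 : ℝ) ≤ 1 by norm_num) z)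
        (fun s _ ↦ z.norm_coe_le_norm _)
      refine this.trans ?_
      have ht : |(t : ℝ) - 0| ≤ 1 := by
        rw [sub_zero, abs_le]; exact t.2
      nlinarith [norm_nonneg z])

theorem primitive_apply (z : C(TimeInterval, E)) (t : TimeInterval) :
    primitive E z t = ∫ s in (0 : ℝ)..t, z (Set.projIcc (-1) 1 (by norm_num) s) := rfl

theorem hasDerivAt_primitive [CompleteSpace E] (z : C(TimeInterval, E)) {t : ℝ}
    (ht : t ∈ Set.Ioo (-1 : ℝ) 1) :
    HasDerivAt (fun s ↦ primitive E z (Set.projIcc (-1) 1 (by norm_num) s))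
      (z (Set.projIcc (-1) 1 (by norm_num) t)) t := by
  have hc : Continuous fun s ↦ z (Set.projIcc (-1) 1 (by norm_num) s) :=
    z.continuous.comp continuous_projIcc
  have h := intervalIntegral.integral_hasDerivAt_right (hc.intervalIntegrable 0 t)
    (hc.stronglyMeasurableAtFilter _ _) hc.continuousAt
  refine h.congr_of_eventuallyEq ?_
  filter_upwards [isOpen_Ioo.mem_nhds ht] with s hs
  rw [primitive_apply, Set.projIcc_of_mem _ (Set.Ioo_subset_Icc_self hs)]

/-- The time rescaling `t ↦ s t` of `[-1,1]`, for `|s| ≤ 1`. -/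
def timeRescale (s : TimeInterval) : C(TimeInterval, TimeInterval) :=
  ⟨fun t ↦ ⟨s * t, by
    rw [Set.mem_Icc, ← abs_le, abs_mul]
    exact mul_le_one₀ (abs_le.2 s.2) (abs_nonneg _) (abs_le.2 t.2)⟩, by fun_prop⟩

/-- Change of variables x ↦ s x, with s kept as a factor so that s = 0 is included. It lies behind
the homogeneity of geodesics: running s times slower is starting with velocity s v. -/
theorem primitive_timeRescale (z : C(TimeInterval, E)) (s t : TimeInterval) :
    (s : ℝ) • primitive E (z.comp (timeRescale s)) t = primitive E z (timeRescale s t) := by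
  rw [primitive_apply, primitive_apply]
  have h := intervalIntegral.smul_integral_comp_mul_left (a := 0) (b := (t : ℝ))
    (fun x ↦ z (Set.projIcc (-1) 1 (by norm_num) x)) (s : ℝ)
  rw [mul_zero] at h
  refine Eq.trans ?_ h
  congr 1
  refine intervalIntegral.integral_congr fun x hx ↦ ?_
  have hx1 : x ∈ Set.Icc (-1 : ℝ) 1 :=
    Set.uIcc_subset_Icc (by norm_num) t.2 hx
  have hx2 : (s : ℝ) * x ∈ Set.Icc (-1 : ℝ) 1 := (timeRescale s ⟨x, hx1⟩).2
  simp only [ContinuousMap.comp_apply]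
  rw [Set.projIcc_of_mem _ hx1, Set.projIcc_of_mem _ hx2]
  rfl

end Integration

/-! ### The analytic exponential map of a connection on a vector space. -/

section GeodesicFlow

variable {E : Type*} [NormedAddCommGroup E] [NormedSpace ℝ E]

/-- The pairing of two `E`-valued functions on `[-1,1]`. -/
def pairing (E : Type*) [NormedAddCommGroup E] [NormedSpace ℝ E] :
    C(TimeInterval, E) →L[ℝ] C(TimeInterval, E × E) :=
  (ContinuousLinearMap.compLeftContinuous ℝ TimeInterval (ContinuousLinearMap.inl ℝ E E)).comp
      (primitive E)
    + ContinuousLinearMap.compLeftContinuous ℝ TimeInterval (ContinuousLinearMap.inr ℝ E E)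

theorem pairing_apply (z : C(TimeInterval, E)) (t : TimeInterval) :
    pairing E z t = (primitive E z t, z t) := by
  simp [pairing]

variable {Γ : E → E →L[ℝ] E →L[ℝ] E} {x₀ : E}

/-- The spray is quadratic in the velocity, so it has no first-order term at rest. This makes the
linearised integral equation trivial. -/
theorem fderiv_geodesicSpray (hΓ : AnalyticAt ℝ Γ x₀) :
    fderiv ℝ (fun q : E × E ↦ Γ (x₀ + q.1) q.2 q.2) 0 = 0 := by
  have h1 : AnalyticAt ℝ (fun q : E × E ↦ Γ (x₀ + q.1)) 0 := by
    refine AnalyticAt.fun_comp (g := Γ) ?_ (analyticAt_const.add analyticAt_fst)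
    simpa using hΓ
  have h2 := (h1.differentiableAt.hasFDerivAt.clm_apply
    (hasFDerivAt_snd (𝕜 := ℝ) (p := ((0 : E), (0 : E))))).clm_apply
      (hasFDerivAt_snd (𝕜 := ℝ) (p := ((0 : E), (0 : E))))
  refine (HasFDerivAt.fderiv h2).trans ?_
  ext <;> simp

variable [CompleteSpace E]

theorem analyticAt_geodesicSpray (hΓ : AnalyticAt ℝ Γ x₀) :
    AnalyticAt ℝ (fun q : E × E ↦ Γ (x₀ + q.1) q.2 q.2) 0 := by
  have h1 : AnalyticAt ℝ (fun q : E × E ↦ Γ (x₀ + q.1)) 0 := by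
    refine AnalyticAt.fun_comp (g := Γ) ?_ (analyticAt_const.add analyticAt_fst)
    simpa using hΓ
  exact ((h1.contDiffAt (n := ω)).clm_apply contDiffAt_snd |>.clm_apply contDiffAt_snd).analyticAt

/-- Small solutions of the geodesic equation, as a locally invertible analytic family. -/
theorem exists_geodesic_velocity (hΓ : AnalyticAt ℝ Γ x₀) :
    ∃ Z : E → C(TimeInterval, E), AnalyticAt ℝ Z 0 ∧ Z 0 = 0 ∧
      (∀ v, fderiv ℝ Z 0 v = ContinuousMap.const _ v) ∧
      ∃ N : C(TimeInterval, E) → C(TimeInterval, E), ∀ᶠ v in 𝓝 (0 : E),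
        (∀ t, N (Z v) t = Γ (x₀ + primitive E (Z v) t) (Z v t) (Z v t)) ∧
        (∀ t, Z v t + primitive E (N (Z v)) t = v) ∧
        ∀ s : TimeInterval, Z ((s : ℝ) • v) = (s : ℝ) • (Z v).comp (timeRescale s) := by
  -- The unknown is the velocity z, with position x₀ + ∫z. The geodesic equation z' = -Γ(x₀ + ∫z)(z,
  -- z) with z(0) = v becomes z + ∫N(z) = v.
  obtain ⟨r, hr, N₀, hN, hNf⟩ := exists_analytic_superposition (K := TimeInterval)
    (analyticAt_geodesicSpray hΓ)
  simp only [zero_add] at hNf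
  have hN00 : fderiv ℝ N₀ 0 = 0 := by
    ext y t
    have hd : HasFDerivAt N₀ (fderiv ℝ N₀ 0) 0 :=
      (hN 0 (Metric.mem_ball_self hr)).differentiableAt.hasFDerivAt
    have h1 := (ContinuousMap.evalCLM ℝ t : C(TimeInterval, E) →L[ℝ] E).hasFDerivAt.comp
      (0 : C(TimeInterval, E × E)) hd
    have h2 := HasFDerivAt.comp (0 : C(TimeInterval, E × E))
      (by simpa using (analyticAt_geodesicSpray hΓ).differentiableAt.hasFDerivAt)
      (ContinuousMap.evalCLM ℝ t : C(TimeInterval, E × E) →L[ℝ] E × E).hasFDerivAt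
    have h3 := h1.unique (h2.congr_of_eventuallyEq (by
      filter_upwards [Metric.ball_mem_nhds _ hr] with y hy
      exact hNf y hy t))
    have h4 := congrArg (fun L ↦ L y) h3
    simpa [fderiv_geodesicSpray hΓ] using h4
  let N : C(TimeInterval, E) → C(TimeInterval, E) := fun z ↦ N₀ (pairing E z)
  have hNan : AnalyticAt ℝ N 0 :=
    AnalyticAt.fun_comp (g := N₀) (by simpa using hN 0 (Metric.mem_ball_self hr))
      ((pairing E).analyticAt 0)
  have hN0 : HasFDerivAt N (0 : C(TimeInterval, E) →L[ℝ] C(TimeInterval, E)) 0 := by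
    have hd : HasFDerivAt N₀ (fderiv ℝ N₀ 0) 0 :=
      (hN 0 (Metric.mem_ball_self hr)).differentiableAt.hasFDerivAt
    have := HasFDerivAt.comp (0 : C(TimeInterval, E)) (by simpa using hd) (pairing E).hasFDerivAt
    simpa [hN00] using! this
  have hNball : ∀ᶠ z in 𝓝 (0 : C(TimeInterval, E)), ∀ t,
      N z t = Γ (x₀ + primitive E z t) (z t) (z t) := by
    have : (pairing E) ⁻¹' Metric.ball 0 r ∈ 𝓝 (0 : C(TimeInterval, E)) :=
      (pairing E).continuous.continuousAt.preimage_mem_nhds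
        (by simpa using Metric.ball_mem_nhds _ hr)
    filter_upwards [this] with z hz t
    have := hNf _ hz t
    simpa only [pairing_apply] using this
  -- The equation is Ψ z = v (constant function). Since DN(0) = 0, the derivative of Ψ at 0 is the
  -- identity and Ψ is locally invertible.
  let Ψ : C(TimeInterval, E) → C(TimeInterval, E) := fun z ↦ z + primitive E (N z)
  have hΨ : AnalyticAt ℝ Ψ 0 :=
    analyticAt_id.add (AnalyticAt.fun_comp ((primitive E).analyticAt _) hNan)
  have hΨ' : HasFDerivAt Ψ
      ((ContinuousLinearEquiv.refl ℝ C(TimeInterval, E) : _ ≃L[ℝ] _) :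
        C(TimeInterval, E) →L[ℝ] C(TimeInterval, E)) 0 := by
    have := (hasFDerivAt_id (𝕜 := ℝ) (0 : C(TimeInterval, E))).add
      ((primitive E).hasFDerivAt.comp (0 : C(TimeInterval, E)) hN0)
    simpa using! this
  have hΨc : ContDiffAt ℝ ω Ψ 0 := hΨ.contDiffAt
  let H := hΨc.toOpenPartialHomeomorph Ψ hΨ' (by simp)
  have hHcoe : (H : C(TimeInterval, E) → C(TimeInterval, E)) = Ψ :=
    hΨc.toOpenPartialHomeomorph_coe hΨ' (by simp)
  have hHs : (0 : C(TimeInterval, E)) ∈ H.source :=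
    hΨc.mem_toOpenPartialHomeomorph_source hΨ' (by simp)
  have hNz : N 0 = 0 := by
    ext t
    have := hNball.self_of_nhds t
    simpa using this
  have hΨ0 : Ψ 0 = 0 := by simp [Ψ, hNz]
  have hHt : (0 : C(TimeInterval, E)) ∈ H.target := by
    have := H.map_source hHs
    rwa [hHcoe, hΨ0] at this
  have hHsymm0 : H.symm 0 = 0 := by
    have := H.left_inv hHs
    rwa [hHcoe, hΨ0] at this
  have hsymmD : HasFDerivAt H.symm (ContinuousLinearMap.id ℝ C(TimeInterval, E)) 0 := by
    have := H.hasFDerivAt_symm (f' := ContinuousLinearEquiv.refl ℝ C(TimeInterval, E)) hHt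
      (by rw [hHsymm0, hHcoe]; exact hΨ')
    simpa using! this
  have hsymmA : AnalyticAt ℝ H.symm 0 :=
    H.analyticAt_symm (i := ContinuousLinearEquiv.refl ℝ C(TimeInterval, E)) hHt
      (by rw [hHsymm0, hHcoe]; exact hΨ) (by rw [hHsymm0, hHcoe]; exact hΨ'.fderiv)
  let c : E →L[ℝ] C(TimeInterval, E) := ContinuousLinearMap.const ℝ TimeInterval
  have hc (v : E) : c v = ContinuousMap.const _ v := rfl
  refine ⟨fun v ↦ H.symm (c v), ?_, by simp [hHsymm0], ?_, N, ?_⟩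
  · exact AnalyticAt.fun_comp (by simpa using hsymmA) (c.analyticAt 0)
  · intro v
    have := HasFDerivAt.comp (0 : E) (by simpa using hsymmD) c.hasFDerivAt
    rw [← hc]
    simpa using! congrArg (fun L ↦ L v) (HasFDerivAt.fderiv this)
  · have hcont : ContinuousAt (fun v ↦ H.symm (c v)) (0 : E) :=
      (AnalyticAt.fun_comp (g := H.symm) (f := c) (by simpa using hsymmA) (c.analyticAt 0)).continuousAt
    have hZ0 : H.symm (c 0) = 0 := by simp [hHsymm0]
    -- A ball is chosen because it is stable under z ↦ s z(s ·) for |s| ≤ 1, so the rescaled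
    -- velocity stays where Ψ is injective.
    obtain ⟨δ, hδ, hδs⟩ := Metric.mem_nhds_iff.1 (Filter.inter_mem (H.open_source.mem_nhds hHs) hNball)
    have hct : ∀ᶠ v in 𝓝 (0 : E), c v ∈ H.target :=
      c.continuous.continuousAt.preimage_mem_nhds (by simpa using H.open_target.mem_nhds hHt)
    obtain ⟨ρ, hρ, hρt⟩ := Metric.eventually_nhds_iff_ball.1 hct
    have hsm : ∀ᶠ v in 𝓝 (0 : E), H.symm (c v) ∈ Metric.ball (0 : C(TimeInterval, E)) δ :=
      hcont.preimage_mem_nhds (by rw [hZ0]; exact Metric.ball_mem_nhds _ hδ)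
    filter_upwards [hsm, Metric.ball_mem_nhds (0 : E) hρ] with v hv hvρ
    have hsol : Ψ (H.symm (c v)) = c v := by
      have := H.right_inv (hρt v hvρ)
      rwa [hHcoe] at this
    have hsol' (t : TimeInterval) :
        H.symm (c v) t + primitive E (N (H.symm (c v))) t = v := by
      have := congrArg (fun g : C(TimeInterval, E) ↦ g t) hsol
      simpa [Ψ, hc] using this
    refine ⟨(hδs hv).2, hsol', fun s ↦ ?_⟩
    set z := H.symm (c v) with hz
    set zs : C(TimeInterval, E) := (s : ℝ) • z.comp (timeRescale s) with hzs
    have hs1 : |(s : ℝ)| ≤ 1 := abs_le.2 s.2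
    have hzsmem : zs ∈ Metric.ball (0 : C(TimeInterval, E)) δ := by
      rw [mem_ball_zero_iff] at hv ⊢
      refine lt_of_le_of_lt ?_ hv
      rw [ContinuousMap.norm_le _ (norm_nonneg _)]
      intro t
      have := z.norm_coe_le_norm (timeRescale s t)
      simp only [hzs, ContinuousMap.smul_apply, ContinuousMap.comp_apply, norm_smul,
        Real.norm_eq_abs]
      calc _ ≤ 1 * ‖z‖ := by gcongr
        _ = _ := one_mul _
    have hprim (t : TimeInterval) : primitive E zs t = primitive E z (timeRescale s t) := by
      rw [hzs, map_smul, ContinuousMap.smul_apply, primitive_timeRescale]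
    -- Quadratic homogeneity gives s². Integration absorbs one factor into the change of time, and
    -- the other matches the initial velocity s v.
    have hNs : N zs = (s : ℝ) • (s : ℝ) • (N z).comp (timeRescale s) := by
      ext t
      simp only [(hδs hzsmem).2 t, hprim, ContinuousMap.smul_apply, ContinuousMap.comp_apply,
        (hδs hv).2 (timeRescale s t)]
      simp [hzs]
    have hΨs : Ψ zs = c ((s : ℝ) • v) := by
      ext t
      simp only [Ψ, hNs, map_smul, ContinuousMap.add_apply, ContinuousMap.smul_apply,
        primitive_timeRescale, hc, ContinuousMap.const_apply]
      rw [← hsol' (timeRescale s t), smul_add]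
      rfl
    change H.symm (c ((s : ℝ) • v)) = zs
    -- Both sides solve the equation with initial velocity s v, and Ψ is injective on the ball.
    have := H.left_inv (hδs hzsmem).1
    rwa [hHcoe, hΨs] at this

/-- Existence of an analytic exponential map for an analytic connection on a vector space. -/
theorem exists_analytic_exp (hΓ : AnalyticAt ℝ Γ x₀) :
    ∃ f : E → E, ∃ ρ > 0, AnalyticOnNhd ℝ f (Metric.ball 0 (2 * ρ)) ∧ f 0 = x₀ ∧
      fderiv ℝ f 0 = ContinuousLinearMap.id ℝ E ∧
      ∀ v ∈ Metric.ball (0 : E) ρ, ∀ t ∈ Set.Ioo (-2 : ℝ) 2,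
        fderiv ℝ (fderiv ℝ f) (t • v) v v
          + Γ (f (t • v)) (fderiv ℝ f (t • v) v) (fderiv ℝ f (t • v) v) = 0 := by
  obtain ⟨Z, hZ, hZ0, hZ', N, hN⟩ := exists_geodesic_velocity hΓ
  let one : TimeInterval := ⟨1, by norm_num, by norm_num⟩
  let ev : C(TimeInterval, E) →L[ℝ] E := (ContinuousMap.evalCLM ℝ one).comp (primitive E)
  -- The exponential map is the position at time 1.
  let f : E → E := fun v ↦ x₀ + ev (Z v)
  have hf : AnalyticAt ℝ f 0 := analyticAt_const.add (AnalyticAt.fun_comp (ev.analyticAt _) hZ)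
  obtain ⟨ρ, hρ, hρf⟩ := Metric.eventually_nhds_iff_ball.1 (hf.eventually_analyticAt.and hN)
  have hfd : fderiv ℝ f 0 = ContinuousLinearMap.id ℝ E := by
    have h1 := (ev.hasFDerivAt (x := Z 0)).comp (0 : E) hZ.differentiableAt.hasFDerivAt
    have h2 := h1.const_add x₀
    refine (HasFDerivAt.fderiv h2).trans ?_
    ext v
    simp only [ContinuousLinearMap.comp_apply, hZ', ev, ContinuousLinearMap.id_apply]
    change primitive E (ContinuousMap.const _ v) one = v
    rw [primitive_apply]
    simp [one]
  have key : ∀ v ∈ Metric.ball (0 : E) ρ, ∀ t ∈ Set.Ioo (-1 : ℝ) 1,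
        fderiv ℝ (fderiv ℝ f) (t • v) v v
          + Γ (f (t • v)) (fderiv ℝ f (t • v) v) (fderiv ℝ f (t • v) v) = 0 := by
    intro v hv t ht
    obtain ⟨hNv, hsol, hres⟩ := (hρf v hv).2
    let P : ℝ → TimeInterval := Set.projIcc (-1) 1 (by norm_num)
    have hP (s : ℝ) (hs : s ∈ Set.Ioo (-1 : ℝ) 1) : ((P s : TimeInterval) : ℝ) = s := by
      simp [P, Set.projIcc_of_mem _ (Set.Ioo_subset_Icc_self hs)]
    -- By homogeneity the time-1 point for s v is the time-s point for v, so f maps rays to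
    -- geodesics.
    have hfs (s : ℝ) (hs : s ∈ Set.Ioo (-1 : ℝ) 1) : f (s • v) = x₀ + primitive E (Z v) (P s) := by
      have h1 := hres (P s)
      have h2 := primitive_timeRescale (Z v) (P s) one
      rw [hP s hs] at h1 h2
      have h3 : timeRescale (P s) one = P s := by
        ext; simp [timeRescale, one]
      rw [h3] at h2
      simp only [f, h1, map_smul]
      rw [← h2]
      rfl
    have hmem (s : ℝ) (hs : s ∈ Set.Ioo (-1 : ℝ) 1) : s • v ∈ Metric.ball (0 : E) ρ := by
      rw [mem_ball_zero_iff] at hv ⊢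
      rw [norm_smul]
      have : ‖s‖ ≤ 1 := (abs_lt.2 hs).le
      calc _ ≤ 1 * ‖v‖ := by gcongr
        _ < ρ := by simpa using hv
    have hline (s : ℝ) : HasDerivAt (fun s : ℝ ↦ s • v) v s := by
      simpa using (hasDerivAt_id s).smul_const v
    have hd1 (s : ℝ) (hs : s ∈ Set.Ioo (-1 : ℝ) 1) : fderiv ℝ f (s • v) v = Z v (P s) := by
      have h1 := ((hρf _ (hmem s hs)).1.differentiableAt.hasFDerivAt).comp_hasDerivAt s (hline s)
      have h2 := (hasDerivAt_primitive (Z v) hs).const_add x₀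
      refine h1.unique (h2.congr_of_eventuallyEq ?_)
      filter_upwards [isOpen_Ioo.mem_nhds hs] with u hu
      exact hfs u hu
    have h1 := ((hρf _ (hmem t ht)).1.fderiv.differentiableAt.hasFDerivAt).comp_hasDerivAt t
      (hline t)
    have h1' := h1.clm_apply (hasDerivAt_const t v)
    have h2 := (hasDerivAt_primitive (N (Z v)) ht).const_sub v
    have h3 := h1'.unique (h2.congr_of_eventuallyEq (by
      filter_upwards [isOpen_Ioo.mem_nhds ht] with u hu
      exact (hd1 u hu).trans (eq_sub_of_add_eq (hsol (P u)))))
    have h4 := hNv (P t)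
    rw [hd1 t ht, hfs t ht, ← h4]
    simp only [map_zero, add_zero] at h3
    rw [h3]
    simp [P]
  -- The equation on (-1,1) must be extended past the endpoints ±1. It is applied to 3v at time t/3,
  -- at the price of a smaller ball; the common factor 9 is then cancelled.
  refine ⟨f, ρ / 3, by positivity, fun v hv ↦ (hρf v (Metric.ball_subset_ball (by linarith) hv)).1,
    ?_, hfd, ?_⟩
  · simp [f, hZ0]
  · intro v hv t ht
    have h := key ((3 : ℝ) • v) (by
      rw [mem_ball_zero_iff] at hv ⊢
      rw [norm_smul]; simp; linarith) (t / 3) ⟨by linarith [ht.1], by linarith [ht.2]⟩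
    rw [smul_smul, div_mul_cancel₀ _ (by norm_num : (3 : ℝ) ≠ 0)] at h
    simp only [map_smul, smul_apply] at h
    rw [← smul_add, ← smul_add, smul_smul] at h
    exact (smul_eq_zero.1 h).resolve_left (by norm_num)

end GeodesicFlow

/-! ### A scalar linear equation and the Jacobi equation. -/

/-- Solutions of `h'' = Q h` with `h 0 = 0` are odd. -/
theorem odd_of_hasDerivAt_const_mul {h h₁ : ℝ → ℝ} {Q : ℝ}
    (hh : ∀ t ∈ Ioo (-2 : ℝ) 2, HasDerivAt h (h₁ t) t)
    (hh₁ : ∀ t ∈ Ioo (-2 : ℝ) 2, HasDerivAt h₁ (Q * h t) t) (h0 : h 0 = 0) :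
    h (-1) = -h 1 := by
  let L : ℝ × ℝ →L[ℝ] ℝ × ℝ :=
    (ContinuousLinearMap.snd ℝ ℝ ℝ).prod (Q • ContinuousLinearMap.fst ℝ ℝ ℝ)
  have hneg (t : ℝ) (ht : t ∈ Ioo (-2 : ℝ) 2) : -t ∈ Ioo (-2 : ℝ) 2 :=
    ⟨by linarith [ht.2], by linarith [ht.1]⟩
  -- The even part of h with its derivative (up to the factor 2) solves the same linear system and
  -- vanishes at 0, hence is zero.
  let g : ℝ → ℝ × ℝ := fun t ↦ (h t + h (-t), h₁ t - h₁ (-t))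
  have hg : ∀ t ∈ Ioo (-2 : ℝ) 2, HasDerivAt g (L (g t)) t := by
    intro t ht
    have h1 := (hh t ht).add ((hh _ (hneg t ht)).comp t (hasDerivAt_neg t))
    have h2 := (hh₁ t ht).sub ((hh₁ _ (hneg t ht)).comp t (hasDerivAt_neg t))
    refine (h1.prodMk h2).congr_deriv ?_
    ext <;> simp [L, g] <;> ring
  have hz : ∀ t ∈ Ioo (-2 : ℝ) 2, HasDerivAt (fun _ : ℝ ↦ (0 : ℝ × ℝ)) (L 0) t := by
    intro t _
    simpa using hasDerivAt_const t (0 : ℝ × ℝ)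
  have := ODE_solution_unique_of_mem_Ioo (v := fun _ ↦ L) (s := fun _ ↦ univ) (K := ‖L‖₊)
    (fun _ _ ↦ L.lipschitz.lipschitzOnWith) (t₀ := 0) (by norm_num)
    (fun t ht ↦ ⟨hg t ht, mem_univ _⟩) (fun t ht ↦ ⟨hz t ht, mem_univ _⟩) (by simp [g, h0])
    (show (1 : ℝ) ∈ Ioo (-2 : ℝ) 2 by norm_num)
  have := congrArg Prod.fst this
  simp only [g, Prod.fst_zero] at this
  linarith

theorem smul_mem_ball_two_mul {E : Type*} [NormedAddCommGroup E] [NormedSpace ℝ E] {ρ : ℝ}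
    {v : E} (hv : v ∈ Metric.ball (0 : E) ρ) {t : ℝ}
    (ht : t ∈ Ioo (-2 : ℝ) 2) : t • v ∈ Metric.ball (0 : E) (2 * ρ) := by
  rw [mem_ball_zero_iff] at hv ⊢
  rw [norm_smul]
  have h1 : ‖t‖ < 2 := abs_lt.2 ht
  have h2 := norm_nonneg v
  have h3 := norm_nonneg t
  nlinarith

section Jacobi

variable {E : Type*} [NormedAddCommGroup E] [NormedSpace ℝ E] [CompleteSpace E]
  {Γ : E → E →L[ℝ] E →L[ℝ] E} {f : E → E} {ρ : ℝ}

/-- The Jacobi equation for the field `t ↦ t • Df(t v) w` along the geodesic `t ↦ f(t v)`. -/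
theorem jacobi_equation (hΓ : ∀ x ∈ Metric.ball (0 : E) (2 * ρ), DifferentiableAt ℝ Γ (f x))
    (hf : AnalyticOnNhd ℝ f (Metric.ball 0 (2 * ρ)))
    (hsymm : ∀ x ∈ Metric.ball (0 : E) (2 * ρ), ∀ u v, Γ (f x) u v = Γ (f x) v u)
    (hgeo : ∀ v ∈ Metric.ball (0 : E) ρ, ∀ t ∈ Ioo (-2 : ℝ) 2,
        fderiv ℝ (fderiv ℝ f) (t • v) v v
          + Γ (f (t • v)) (fderiv ℝ f (t • v) v) (fderiv ℝ f (t • v) v) = 0)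
    {v : E} (hv : v ∈ Metric.ball (0 : E) ρ) (w : E) {t : ℝ} (ht : t ∈ Ioo (-2 : ℝ) 2) :
    HasDerivAt (fun t : ℝ ↦ f (t • v)) (fderiv ℝ f (t • v) v) t ∧
    HasDerivAt (fun t : ℝ ↦ fderiv ℝ f (t • v) v)
      (-Γ (f (t • v)) (fderiv ℝ f (t • v) v) (fderiv ℝ f (t • v) v)) t ∧
    HasDerivAt (fun t : ℝ ↦ t • fderiv ℝ f (t • v) w)
      (t • fderiv ℝ (fderiv ℝ f) (t • v) v w + fderiv ℝ f (t • v) w) t ∧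
    HasDerivAt (fun t : ℝ ↦ t • fderiv ℝ (fderiv ℝ f) (t • v) v w + fderiv ℝ f (t • v) w)
      (-(fderiv ℝ Γ (f (t • v)) (t • fderiv ℝ f (t • v) w) (fderiv ℝ f (t • v) v)
            (fderiv ℝ f (t • v) v))
        - (2 : ℝ) • Γ (f (t • v)) (fderiv ℝ f (t • v) v)
          (t • fderiv ℝ (fderiv ℝ f) (t • v) v w + fderiv ℝ f (t • v) w)) t := by
  have hmem := smul_mem_ball_two_mul hv ht
  have hline : HasDerivAt (fun s : ℝ ↦ s • v) v t := by
    simpa using (hasDerivAt_id t).smul_const v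
  have hf0 := hf _ hmem
  have hf1 := hf0.fderiv
  have hf2 := hf1.fderiv
  have hc := hf0.differentiableAt.hasFDerivAt.comp_hasDerivAt t hline
  have hc1 := hf1.differentiableAt.hasFDerivAt.comp_hasDerivAt t hline
  have hc2 := hf2.differentiableAt.hasFDerivAt.comp_hasDerivAt t hline
  have hsymm2 (x : E) (hx : x ∈ Metric.ball (0 : E) (2 * ρ)) (a b : E) :
      fderiv ℝ (fderiv ℝ f) x a b = fderiv ℝ (fderiv ℝ f) x b a :=
    (ContDiffAt.isSymmSndFDerivAt_of_omega (hf x hx).contDiffAt).eq a b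
  have hsymm3 (a b : E) : fderiv ℝ (fderiv ℝ (fderiv ℝ f)) (t • v) a b
      = fderiv ℝ (fderiv ℝ (fderiv ℝ f)) (t • v) b a :=
    (ContDiffAt.isSymmSndFDerivAt_of_omega hf1.contDiffAt).eq a b
  -- Symmetry in the last two slots comes from differentiating the symmetry of D²f, valid near t v.
  have hsymm3' (a b c : E) : fderiv ℝ (fderiv ℝ (fderiv ℝ f)) (t • v) a b c
      = fderiv ℝ (fderiv ℝ (fderiv ℝ f)) (t • v) a c b := by
    have hd := hf2.differentiableAt.hasFDerivAt
    have h1 := (hd.clm_apply (hasFDerivAt_const b _)).clm_apply (hasFDerivAt_const c _)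
    have h2 := (hd.clm_apply (hasFDerivAt_const c _)).clm_apply (hasFDerivAt_const b _)
    have h3 := h1.unique (h2.congr_of_eventuallyEq (by
      filter_upwards [Metric.isOpen_ball.mem_nhds hmem] with x hx
      exact hsymm2 x hx b c))
    simpa using congrArg (fun L ↦ L a) h3
  -- the geodesic equation differentiated in the direction `w`
  have hvar : t • fderiv ℝ (fderiv ℝ (fderiv ℝ f)) (t • v) w v v
      + (2 : ℝ) • fderiv ℝ (fderiv ℝ f) (t • v) v w
      + (fderiv ℝ Γ (f (t • v)) (t • fderiv ℝ f (t • v) w) (fderiv ℝ f (t • v) v)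
            (fderiv ℝ f (t • v) v)
        + (2 : ℝ) • Γ (f (t • v)) (fderiv ℝ f (t • v) v)
          (t • fderiv ℝ (fderiv ℝ f) (t • v) v w + fderiv ℝ f (t • v) w)) = 0 := by
    -- The variation moves the initial velocity along v + s w with t fixed. The result is J'' +
    -- DΓ(J)(c',c') + 2Γ(c',J') = 0, still multiplied out in derivatives of f.
    have hl0 : HasDerivAt (fun s : ℝ ↦ v + s • w) w 0 := by
      simpa using ((hasDerivAt_id (0 : ℝ)).smul_const w).const_add v
    have hl : HasDerivAt (fun s : ℝ ↦ t • (v + s • w)) (t • w) 0 := hl0.const_smul t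
    have hpt : t • (v + (0 : ℝ) • w) = t • v := by simp
    have k0 : HasDerivAt (fun s : ℝ ↦ f (t • (v + s • w))) (fderiv ℝ f (t • v) (t • w)) 0 :=
      hf0.differentiableAt.hasFDerivAt.comp_hasDerivAt_of_eq (0 : ℝ) hl hpt.symm
    have k1 : HasDerivAt (fun s : ℝ ↦ fderiv ℝ f (t • (v + s • w)))
        (fderiv ℝ (fderiv ℝ f) (t • v) (t • w)) 0 :=
      hf1.differentiableAt.hasFDerivAt.comp_hasDerivAt_of_eq (0 : ℝ) hl hpt.symm
    have k2 : HasDerivAt (fun s : ℝ ↦ fderiv ℝ (fderiv ℝ f) (t • (v + s • w)))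
        (fderiv ℝ (fderiv ℝ (fderiv ℝ f)) (t • v) (t • w)) 0 :=
      hf2.differentiableAt.hasFDerivAt.comp_hasDerivAt_of_eq (0 : ℝ) hl hpt.symm
    have kΓ : HasDerivAt (fun s : ℝ ↦ Γ (f (t • (v + s • w))))
        (fderiv ℝ Γ (f (t • v)) (fderiv ℝ f (t • v) (t • w))) 0 :=
      HasFDerivAt.comp_hasDerivAt_of_eq (E := E →L[ℝ] E →L[ℝ] E) (0 : ℝ) (hΓ _ hmem).hasFDerivAt k0
        (by rw [hpt])
    have kv := k1.clm_apply hl0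
    have hG := ((k2.clm_apply hl0).clm_apply hl0).add ((kΓ.clm_apply kv).clm_apply kv)
    have hzero := hG.unique ((hasDerivAt_const (0 : ℝ) (0 : E)).congr_of_eventuallyEq (by
      have : ∀ᶠ s : ℝ in 𝓝 0, v + s • w ∈ Metric.ball (0 : E) ρ :=
        hl0.continuousAt.preimage_mem_nhds (by simpa using Metric.isOpen_ball.mem_nhds hv)
      filter_upwards [this] with s hs
      exact hgeo _ hs t ht))
    simp only [zero_smul, add_zero, map_smul, smul_apply, map_add,
      add_apply] at hzero
    rw [hsymm2 _ hmem w v, hsymm _ hmem _ (fderiv ℝ f (t • v) v),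
      hsymm _ hmem (fderiv ℝ f (t • v) w)] at hzero
    rw [← hzero]
    simp only [map_smul, smul_apply, map_add]
    module
  refine ⟨hc, ?_, ?_, ?_⟩
  · have := hc1.clm_apply (hasDerivAt_const t v)
    refine this.congr_deriv ?_
    rw [map_zero, add_zero]
    exact eq_neg_of_add_eq_zero_left (hgeo v hv t ht)
  · have := (hasDerivAt_id t).smul (hc1.clm_apply (hasDerivAt_const t w))
    refine this.congr_deriv ?_
    simp
  · have h1 := (hasDerivAt_id t).smul ((hc2.clm_apply (hasDerivAt_const t v)).clm_apply
      (hasDerivAt_const t w))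
    have h2 := h1.add (hc1.clm_apply (hasDerivAt_const t w))
    refine h2.congr_deriv ?_
    rw [hsymm3 w v, hsymm3' v w v] at hvar
    have hvar' := eq_neg_of_add_eq_zero_left hvar
    simp only [map_zero, add_zero, id, one_smul]
    rw [← neg_add', ← hvar']
    simp
    module

end Jacobi

/-! ### Area form and curvature of connections on the plane. -/

/-- The coordinate plane. -/
abbrev Plane : Type := EuclideanSpace ℝ (Fin 2)

/-- The standard area form of the plane. -/
def areaForm : Plane →L[ℝ] Plane →L[ℝ] ℝ :=
  (EuclideanSpace.proj (𝕜 := ℝ) (0 : Fin 2)).smulRight (EuclideanSpace.proj (𝕜 := ℝ) (1 : Fin 2))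
    - (EuclideanSpace.proj (𝕜 := ℝ) (1 : Fin 2)).smulRight
      (EuclideanSpace.proj (𝕜 := ℝ) (0 : Fin 2))

theorem areaForm_apply (u v : Plane) : areaForm u v = u 0 * v 1 - u 1 * v 0 := by
  simp [areaForm]

theorem Plane.eq_sum_single (u : Plane) :
    u = u 0 • EuclideanSpace.single 0 1 + u 1 • EuclideanSpace.single 1 1 := by
  ext i; fin_cases i <;> simp

/-- An alternating bilinear map on the plane is a multiple of the area form. -/
theorem eq_areaForm_smul {F : Type*} [AddCommGroup F] [Module ℝ F]
    (B : Plane → Plane → F) (hadd : ∀ u u' v, B (u + u') v = B u v + B u' v)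
    (hsmul : ∀ (c : ℝ) u v, B (c • u) v = c • B u v) (halt : ∀ u v, B u v = -B v u) (u v : Plane) :
    B u v = areaForm u v • B (EuclideanSpace.single 0 1) (EuclideanSpace.single 1 1) := by
  have hadd' (u v v' : Plane) : B u (v + v') = B u v + B u v' := by
    rw [halt, hadd, halt v, halt v']; module
  have hsmul' (c : ℝ) (u v : Plane) : B u (c • v) = c • B u v := by
    rw [halt, hsmul, halt v]; module
  have h0 (u : Plane) : B u u = 0 := by
    have h := halt u u
    have h2 : (2 : ℝ) • B u u = 0 := by
      rw [two_smul]; nth_rewrite 2 [h]; simp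
    exact (smul_eq_zero.1 h2).resolve_left (by norm_num)
  conv_lhs => rw [Plane.eq_sum_single u, Plane.eq_sum_single v]
  simp only [hadd, hadd', hsmul, hsmul', h0, areaForm_apply]
  rw [halt (EuclideanSpace.single 1 1) (EuclideanSpace.single 0 1)]
  module

section Curvature

variable (Γ : Plane → Plane →L[ℝ] Plane →L[ℝ] Plane)

/-- The curvature of the connection with Christoffel symbols `Γ`. -/
def curvatureOfChristoffel {E : Type*} [NormedAddCommGroup E] [NormedSpace ℝ E]
    (Γ : E → E →L[ℝ] E →L[ℝ] E) (y u v z : E) : E :=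
  fderiv ℝ Γ y u v z - fderiv ℝ Γ y v u z + Γ y u (Γ y v z) - Γ y v (Γ y u z)

/-- The curvature operator `R(∂₀, ∂₁)` of the connection with Christoffel symbols `Γ`. -/
def curvatureOperator (y : Plane) : Plane →L[ℝ] Plane :=
  fderiv ℝ Γ y (EuclideanSpace.single 0 1) (EuclideanSpace.single 1 1)
    - fderiv ℝ Γ y (EuclideanSpace.single 1 1) (EuclideanSpace.single 0 1)
    + (Γ y (EuclideanSpace.single 0 1)).comp (Γ y (EuclideanSpace.single 1 1))
    - (Γ y (EuclideanSpace.single 1 1)).comp (Γ y (EuclideanSpace.single 0 1))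

/-- Alternating forms in two variables on the plane form a line, so one operator carries the whole
curvature. This is one of the two uses of dimension two on which the argument turns. -/
theorem curvatureOfChristoffel_eq (y u v z : Plane) :
    curvatureOfChristoffel Γ y u v z = areaForm u v • curvatureOperator Γ y z := by
  refine eq_areaForm_smul (fun u v ↦ curvatureOfChristoffel Γ y u v z) ?_ ?_ ?_ u v
  · intro u u' v
    simp only [curvatureOfChristoffel, map_add, add_apply]
    module
  · intro c u v
    simp only [curvatureOfChristoffel, map_smul, smul_apply]
    module
  · intro u v
    simp only [curvatureOfChristoffel]
    module

variable {Γ}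

theorem differentiableAt_curvatureOperator {y : Plane} (hΓ : AnalyticAt ℝ Γ y) :
    DifferentiableAt ℝ (curvatureOperator Γ) y := by
  have h1 := hΓ.fderiv.differentiableAt
  have h0 := hΓ.differentiableAt
  have hd (u v : Plane) : DifferentiableAt ℝ (fun y ↦ fderiv ℝ Γ y u v) y :=
    (h1.clm_apply (differentiableAt_const u)).clm_apply (differentiableAt_const v)
  have hg (u : Plane) : DifferentiableAt ℝ (fun y ↦ Γ y u) y :=
    h0.clm_apply (differentiableAt_const u)
  exact (((hd _ _).sub (hd _ _)).add ((hg _).clm_comp (hg _))).sub ((hg _).clm_comp (hg _))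

end Curvature

/-! ### Evenness of the pulled-back area form. -/

/-- The exponential map of a torsion-free connection of the plane with cyclic parallel Ricci
curvature pulls a parallel area form back to an even form. -/
theorem even_pullback_of_cyclic {Γ : Plane → Plane →L[ℝ] Plane →L[ℝ] Plane} {f : Plane → Plane}
    {w : Plane → Plane →L[ℝ] Plane →L[ℝ] ℝ} {U : Set Plane} {ρ : ℝ}
    (hfU : MapsTo f (Metric.ball 0 (2 * ρ)) U) (hUo : IsOpen U)
    (hΓ : AnalyticOnNhd ℝ Γ U) (hsymm : ∀ y ∈ U, ∀ u v, Γ y u v = Γ y v u)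
    (hw : ∀ y ∈ U, DifferentiableAt ℝ w y) (halt : ∀ y ∈ U, ∀ u, w y u u = 0)
    (hpar : ∀ y ∈ U, ∀ u a b, fderiv ℝ w y u a b = w y (Γ y u a) b + w y a (Γ y u b))
    (hcyc : ∀ y ∈ U, ∀ u, areaForm u (fderiv ℝ (curvatureOperator Γ) y u u)
      - areaForm (Γ y u u) (curvatureOperator Γ y u)
      - areaForm u (curvatureOperator Γ y (Γ y u u)) = 0)
    (hf : AnalyticOnNhd ℝ f (Metric.ball 0 (2 * ρ)))
    (hgeo : ∀ v ∈ Metric.ball (0 : Plane) ρ, ∀ t ∈ Ioo (-2 : ℝ) 2,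
        fderiv ℝ (fderiv ℝ f) (t • v) v v
          + Γ (f (t • v)) (fderiv ℝ f (t • v) v) (fderiv ℝ f (t • v) v) = 0)
    {v : Plane} (hv : v ∈ Metric.ball (0 : Plane) ρ) (a b : Plane) :
    w (f (-v)) (fderiv ℝ f (-v) a) (fderiv ℝ f (-v) b) =
      w (f v) (fderiv ℝ f v a) (fderiv ℝ f v b) := by
  have halt' (y : Plane) (hy : y ∈ U) (u u' : Plane) : w y u u' = -w y u' u := by
    have := halt y hy (u + u')
    simp only [map_add, add_apply, halt y hy] at this
    linarith
  have hv1 : v ∈ Metric.ball (0 : Plane) (2 * ρ) := by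
    simpa using smul_mem_ball_two_mul hv (t := 1) (by norm_num)
  have hv2 : -v ∈ Metric.ball (0 : Plane) (2 * ρ) := by
    simpa using smul_mem_ball_two_mul hv (t := -1) (by norm_num)
  -- it suffices to treat pairs containing `v`
  suffices H : ∀ b, w (f (-v)) (fderiv ℝ f (-v) v) (fderiv ℝ f (-v) b) =
      w (f v) (fderiv ℝ f v v) (fderiv ℝ f v b) by
    rcases eq_or_ne v 0 with rfl | hv0
    · simp
    have expand (x : Plane) (hx : x ∈ Metric.ball (0 : Plane) (2 * ρ)) (a b : Plane) :
        w (f x) (fderiv ℝ f x a) (fderiv ℝ f x b) = areaForm a b •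
          w (f x) (fderiv ℝ f x (EuclideanSpace.single 0 1))
            (fderiv ℝ f x (EuclideanSpace.single 1 1)) :=
      eq_areaForm_smul (fun a b ↦ w (f x) (fderiv ℝ f x a) (fderiv ℝ f x b))
        (by simp) (by simp) (fun a b ↦ halt' _ (hfU hx) _ _) a b
    -- Both pulled-back forms are multiples of `areaForm`, so agreement on a single pair (v, b')
    -- with nonzero area is enough.
    obtain ⟨b', hb'⟩ : ∃ b', areaForm v b' ≠ 0 := by
      by_contra! hcon
      apply hv0
      have h0 := hcon (EuclideanSpace.single 1 1)
      have h1 := hcon (EuclideanSpace.single 0 1)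
      rw [areaForm_apply] at h0 h1
      ext i
      fin_cases i
      · simpa using h0
      · simpa using h1
    have := H b'
    rw [expand _ hv2, expand _ hv1] at this
    rw [expand _ hv2, expand _ hv1, smul_right_injective _ hb' this]
  intro b
  let c : ℝ → Plane := fun t ↦ f (t • v)
  let c₁ : ℝ → Plane := fun t ↦ fderiv ℝ f (t • v) v
  let J : ℝ → Plane := fun t ↦ t • fderiv ℝ f (t • v) b
  let J₁ : ℝ → Plane := fun t ↦ t • fderiv ℝ (fderiv ℝ f) (t • v) v b + fderiv ℝ f (t • v) b
  have hcU (t : ℝ) (ht : t ∈ Ioo (-2 : ℝ) 2) : c t ∈ U := hfU (smul_mem_ball_two_mul hv ht)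
  have hjac (t : ℝ) (ht : t ∈ Ioo (-2 : ℝ) 2) := jacobi_equation
    (fun x hx ↦ (hΓ _ (hfU hx)).differentiableAt) hf (fun x hx ↦ hsymm _ (hfU hx)) hgeo hv b ht
  have hsymmD (y : Plane) (hy : y ∈ U) (a u v : Plane) :
      fderiv ℝ Γ y a u v = fderiv ℝ Γ y a v u := by
    have hd := (hΓ y hy).differentiableAt.hasFDerivAt
    have h1 := (hd.clm_apply (hasFDerivAt_const u _)).clm_apply (hasFDerivAt_const v _)
    have h2 := (hd.clm_apply (hasFDerivAt_const v _)).clm_apply (hasFDerivAt_const u _)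
    have h3 := h1.unique (h2.congr_of_eventuallyEq (by
      filter_upwards [hUo.mem_nhds hy] with x hx
      exact hsymm x hx u v))
    simpa using congrArg (fun L ↦ L a) h3
  -- Since w is parallel, d/dt w(X,Y) = w(∇X, Y) + w(X, ∇Y), with ∇ the covariant derivative along
  -- c.
  have hparc (t : ℝ) (ht : t ∈ Ioo (-2 : ℝ) 2) {X Y : ℝ → Plane} {X' Y' : Plane}
      (hX : HasDerivAt X X' t) (hY : HasDerivAt Y Y' t) :
      HasDerivAt (fun t ↦ w (c t) (X t) (Y t))
        (w (c t) (X' + Γ (c t) (c₁ t) (X t)) (Y t)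
          + w (c t) (X t) (Y' + Γ (c t) (c₁ t) (Y t))) t := by
    have h1 : HasDerivAt (fun t ↦ w (c t)) (fderiv ℝ w (c t) (c₁ t)) t :=
      HasFDerivAt.comp_hasDerivAt (E := Plane →L[ℝ] Plane →L[ℝ] ℝ) t
        (hw _ (hcU t ht)).hasFDerivAt (hjac t ht).1
    refine ((h1.clm_apply hX).clm_apply hY).congr_deriv ?_
    simp only [add_apply, hpar _ (hcU t ht), map_add]
    ring
  -- This is r(c',c'). As ∇c' = 0, its derivative is (∇r)(c',c',c'), which vanishes by `hcyc`.
  let q : ℝ → ℝ := fun t ↦ areaForm (c₁ t) (curvatureOperator Γ (c t) (c₁ t))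
  have hq : ∀ t ∈ Ioo (-2 : ℝ) 2, HasDerivAt q 0 t := by
    intro t ht
    have h1 : HasDerivAt (fun t ↦ curvatureOperator Γ (c t))
        (fderiv ℝ (curvatureOperator Γ) (c t) (c₁ t)) t :=
      HasFDerivAt.comp_hasDerivAt (E := Plane →L[ℝ] Plane) t
        (differentiableAt_curvatureOperator (hΓ _ (hcU t ht))).hasFDerivAt (hjac t ht).1
    have h2 : HasDerivAt c₁ _ t := (hjac t ht).2.1
    have h3 := ((hasDerivAt_const t areaForm).clm_apply h2).clm_apply (h1.clm_apply h2)
    refine h3.congr_deriv ?_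
    rw [← hcyc _ (hcU t ht) (c₁ t)]
    simp only [add_apply, map_add, map_neg, neg_apply, zero_apply, c, c₁]
    ring
  have hqc : ∀ t ∈ Ioo (-2 : ℝ) 2, q t = q 0 := by
    intro t ht
    refine isOpen_Ioo.is_const_of_deriv_eq_zero isPreconnected_Ioo
      (fun s hs ↦ (hq s hs).differentiableAt.differentiableWithinAt)
      (fun s hs ↦ (hq s hs).deriv) ht (by norm_num)
  -- P is the covariant derivative ∇J along c; since ∇c' = 0, the derivative of w(c', J) is w(c',
  -- P).
  let P : ℝ → Plane := fun t ↦ J₁ t + Γ (c t) (c₁ t) (J t)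
  let h : ℝ → ℝ := fun t ↦ w (c t) (c₁ t) (J t)
  let h₁ : ℝ → ℝ := fun t ↦ w (c t) (c₁ t) (P t)
  have hh : ∀ t ∈ Ioo (-2 : ℝ) 2, HasDerivAt h (h₁ t) t := by
    intro t ht
    refine (hparc t ht (hjac t ht).2.1 (hjac t ht).2.2.1).congr_deriv ?_
    simp [h₁, P, J₁, J, c, c₁]
  have hh₁ : ∀ t ∈ Ioo (-2 : ℝ) 2, HasDerivAt h₁ (q 0 * h t) t := by
    intro t ht
    obtain ⟨e0, e1, e2, e3⟩ := hjac t ht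
    have eΓ : HasDerivAt (fun t ↦ Γ (c t)) (fderiv ℝ Γ (c t) (c₁ t)) t :=
      HasFDerivAt.comp_hasDerivAt (E := Plane →L[ℝ] Plane →L[ℝ] Plane) t
        (hΓ _ (hcU t ht)).differentiableAt.hasFDerivAt e0
    have eP : HasDerivAt P _ t := e3.add ((eΓ.clm_apply e1).clm_apply e2)
    refine (hparc t ht e1 eP).congr_deriv ?_
    have hR := curvatureOfChristoffel_eq Γ (c t) (c₁ t) (J t) (c₁ t)
    have hWA := eq_areaForm_smul (fun a b ↦ w (c t) a b) (by simp) (by simp)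
      (halt' _ (hcU t ht))
    rw [← hqc t ht]
    have hs := hsymm _ (hcU t ht)
    have hsD := hsymmD _ (hcU t ht)
    -- Covariant form of the Jacobi equation: ∇∇J = R(c',J)c'.
    have key : (-(fderiv ℝ Γ (c t) (J t) (c₁ t) (c₁ t)) - (2 : ℝ) • Γ (c t) (c₁ t) (J₁ t)
        + ((fderiv ℝ Γ (c t) (c₁ t) (c₁ t) + Γ (c t) (-Γ (c t) (c₁ t) (c₁ t))) (J t)
          + Γ (c t) (c₁ t) (J₁ t)) + Γ (c t) (c₁ t) (P t))
        = areaForm (c₁ t) (J t) • curvatureOperator Γ (c t) (c₁ t) := by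
      rw [← hR]
      simp only [curvatureOfChristoffel, P, map_add, map_neg, add_apply, neg_apply]
      rw [hsD _ (c₁ t) (J t), hs (Γ (c t) (c₁ t) (c₁ t)), hs (J t) (c₁ t)]
      module
    -- As w is a multiple of `areaForm`, the two forms may be exchanged: σ(c',J) w(c',Ac') =
    -- σ(c',Ac') w(c',J). This closes the equation for h.
    have key2 : w (c t) (c₁ t) (areaForm (c₁ t) (J t) • curvatureOperator Γ (c t) (c₁ t))
        = q t * h t := by
      simp only [q, h]
      rw [map_smul, hWA (c₁ t) (J t), hWA (c₁ t) (curvatureOperator Γ (c t) (c₁ t))]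
      simp only [smul_eq_mul]
      ring
    rw [← key2, ← key]
    simp [c, c₁, J, J₁]
  -- The factor t in J contributes a sign at t = -1, so oddness of h is evenness of the pulled-back
  -- form.
  have hodd := odd_of_hasDerivAt_const_mul hh hh₁ (by simp [h, J])
  simp only [h, c, c₁, J, one_smul, neg_smul, map_neg] at hodd
  linarith

/-! ### Coordinate fields, Christoffel symbols and covariant derivatives in a chart. -/

section Charts

variable {n : ℕ} {M : Type*} [TopologicalSpace M] [ChartedSpace (EuclideanSpace ℝ (Fin n)) M]
  {e : OpenPartialHomeomorph M (EuclideanSpace ℝ (Fin n))}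

theorem coordField_add (u v : EuclideanSpace ℝ (Fin n)) (x : M) :
    coordField e (u + v) x = coordField e u x + coordField e v x :=
  map_add (mfderiv (𝓡 n) 𝓘(ℝ, EuclideanSpace ℝ (Fin n)) e x).inverse u v

theorem coordField_smul (c : ℝ) (v : EuclideanSpace ℝ (Fin n)) (x : M) :
    coordField e (c • v) x = c • coordField e v x :=
  map_smul (mfderiv (𝓡 n) 𝓘(ℝ, EuclideanSpace ℝ (Fin n)) e x).inverse c v

theorem coordField_sum {ι : Type*} (s : Finset ι) (u : ι → EuclideanSpace ℝ (Fin n)) (x : M) :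
    coordField e (∑ i ∈ s, u i) x = ∑ i ∈ s, coordField e (u i) x :=
  map_sum (mfderiv (𝓡 n) 𝓘(ℝ, EuclideanSpace ℝ (Fin n)) e x).inverse u s

theorem components_add (x : M) (u v : TangentSpace (𝓡 n) x) :
    components e x (u + v) = components e x u + components e x v :=
  map_add (mfderiv (𝓡 n) 𝓘(ℝ, EuclideanSpace ℝ (Fin n)) e x) u v

theorem components_sub (x : M) (u v : TangentSpace (𝓡 n) x) :
    components e x (u - v) = components e x u - components e x v :=
  map_sub (mfderiv (𝓡 n) 𝓘(ℝ, EuclideanSpace ℝ (Fin n)) e x) u v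

theorem components_smul (x : M) (c : ℝ) (v : TangentSpace (𝓡 n) x) :
    components e x (c • v) = c • components e x v :=
  map_smul (mfderiv (𝓡 n) 𝓘(ℝ, EuclideanSpace ℝ (Fin n)) e x) c v

theorem components_sum {ι : Type*} (s : Finset ι) (x : M) (u : ι → TangentSpace (𝓡 n) x) :
    components e x (∑ i ∈ s, u i) = ∑ i ∈ s, components e x (u i) :=
  map_sum (mfderiv (𝓡 n) 𝓘(ℝ, EuclideanSpace ℝ (Fin n)) e x) u s

/-- The vector field with components `F`, a function of the coordinates, in the chart `e`. -/
def chartField (e : OpenPartialHomeomorph M (EuclideanSpace ℝ (Fin n)))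
    (F : EuclideanSpace ℝ (Fin n) → EuclideanSpace ℝ (Fin n)) : Π x : M, TangentSpace (𝓡 n) x :=
  fun x ↦ coordField e (F (e x)) x

/-- Gives access to the naturality of Lie brackets under pullback. -/
theorem chartField_eq_mpullback (F : EuclideanSpace ℝ (Fin n) → EuclideanSpace ℝ (Fin n)) :
    chartField (M := M) e F
      = VectorField.mpullback (𝓡 n) 𝓘(ℝ, EuclideanSpace ℝ (Fin n)) e F := rfl

theorem coordField_eq_chartField (u : EuclideanSpace ℝ (Fin n)) :
    coordField (M := M) e u = chartField e (fun _ ↦ u) := rfl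

theorem chart_mdifferentiable (he : e ∈ IsManifold.maximalAtlas (𝓡 n) ∞ M) :
    e.MDifferentiable (𝓡 n) (𝓡 n) :=
  ⟨(contMDiffOn_of_mem_maximalAtlas he).mdifferentiableOn (by simp),
    (contMDiffOn_symm_of_mem_maximalAtlas he).mdifferentiableOn (by simp)⟩

theorem isInvertible_mfderiv_chart (he : e ∈ IsManifold.maximalAtlas (𝓡 n) ∞ M) {x : M}
    (hx : x ∈ e.source) :
    (mfderiv (𝓡 n) 𝓘(ℝ, EuclideanSpace ℝ (Fin n)) e x).IsInvertible :=
  ⟨(chart_mdifferentiable he).mfderiv hx, rfl⟩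

theorem components_coordField (he : e ∈ IsManifold.maximalAtlas (𝓡 n) ∞ M) {x : M}
    (hx : x ∈ e.source) (u : EuclideanSpace ℝ (Fin n)) : components e x (coordField e u x) = u := by
  obtain ⟨A, hA⟩ := isInvertible_mfderiv_chart he hx
  rw [components, coordField, ← hA, ContinuousLinearMap.inverse_equiv]
  exact A.apply_symm_apply u

theorem coordField_components (he : e ∈ IsManifold.maximalAtlas (𝓡 n) ∞ M) {x : M}
    (hx : x ∈ e.source) (v : TangentSpace (𝓡 n) x) : coordField e (components e x v) x = v := by
  obtain ⟨A, hA⟩ := isInvertible_mfderiv_chart he hx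
  change (mfderiv (𝓡 n) 𝓘(ℝ, EuclideanSpace ℝ (Fin n)) e x).inverse
    (mfderiv (𝓡 n) 𝓘(ℝ, EuclideanSpace ℝ (Fin n)) e x v) = v
  rw [← hA, ContinuousLinearMap.inverse_equiv]
  exact A.symm_apply_apply v

theorem mdifferentiableAt_comp_chart {F : Type*} [NormedAddCommGroup F] [NormedSpace ℝ F]
    (he : e ∈ IsManifold.maximalAtlas (𝓡 n) ∞ M) {G : EuclideanSpace ℝ (Fin n) → F} {x : M}
    (hx : x ∈ e.source) (hG : DifferentiableAt ℝ G (e x)) :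
    MDifferentiableAt (𝓡 n) 𝓘(ℝ, F) (fun x ↦ G (e x)) x :=
  hG.mdifferentiableAt.comp x ((chart_mdifferentiable he).mdifferentiableAt hx)

/-- Functions on the manifold are differentiated in coordinates. -/
theorem mvfderiv_of_eventuallyEq (he : e ∈ IsManifold.maximalAtlas (𝓡 n) ∞ M) {g : M → ℝ}
    {G : EuclideanSpace ℝ (Fin n) → ℝ} {x : M} (hx : x ∈ e.source)
    (hG : DifferentiableAt ℝ G (e x)) (hg : ∀ x ∈ e.source, g x = G (e x))
    (v : TangentSpace (𝓡 n) x) :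
    mvfderiv (𝓡 n) g x v = fderiv ℝ G (e x) (components e x v) := by
  have h1 : HasMFDerivAt (𝓡 n) 𝓘(ℝ, ℝ) (G ∘ e) x _ :=
    hG.hasFDerivAt.hasMFDerivAt.comp x
      ((chart_mdifferentiable he).mdifferentiableAt hx).hasMFDerivAt
  have h2 := h1.congr_of_eventuallyEq (f₁ := g)
    (by filter_upwards [e.open_source.mem_nhds hx] with z hz using hg z hz)
  rw [mvfderiv, h2.mfderiv]
  rfl

theorem chartField_eq_sum (F : EuclideanSpace ℝ (Fin n) → EuclideanSpace ℝ (Fin n)) :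
    chartField (M := M) e F
      = ∑ i, (fun x ↦ F (e x) i) • coordField e (EuclideanSpace.single i 1) := by
  funext x
  rw [Finset.sum_apply]
  conv_lhs => rw [chartField, ← (EuclideanSpace.basisFun (Fin n) ℝ).sum_repr (F (e x))]
  rw [coordField_sum]
  refine Finset.sum_congr rfl fun i _ ↦ ?_
  rw [coordField_smul]
  simp

variable [IsManifold (𝓡 n) ∞ M]

theorem isSmoothFieldOn_chartField (he : e ∈ IsManifold.maximalAtlas (𝓡 n) ∞ M)
    {F : EuclideanSpace ℝ (Fin n) → EuclideanSpace ℝ (Fin n)} (hF : ContDiffOn ℝ ∞ F e.target) :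
    IsSmoothFieldOn (chartField (M := M) e F) e.source := by
  intro x hx
  refine ContMDiffAt.contMDiffWithinAt ?_
  have hFx : ContDiffAt ℝ ∞ F (e x) := hF.contDiffAt (e.open_target.mem_nhds (e.map_source hx))
  exact ContMDiffAt.mpullback_vectorField_preimage (n := ∞)
    (contMDiffAt_vectorSpace_iff_contDiffAt.2 hFx) (contMDiffAt_of_mem_maximalAtlas he hx)
    (isInvertible_mfderiv_chart he hx) (by simp)

theorem isSmoothFieldOn_coordField (he : e ∈ IsManifold.maximalAtlas (𝓡 n) ∞ M)
    (u : EuclideanSpace ℝ (Fin n)) : IsSmoothFieldOn (coordField (M := M) e u) e.source :=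
  isSmoothFieldOn_chartField he contDiffOn_const

theorem mdifferentiableAt_coordField (he : e ∈ IsManifold.maximalAtlas (𝓡 n) ∞ M)
    (u : EuclideanSpace ℝ (Fin n)) {x : M} (hx : x ∈ e.source) :
    MDifferentiableAt (𝓡 n) (𝓡 n).tangent
      (fun x ↦ (⟨x, coordField e u x⟩ : TangentBundle (𝓡 n) M)) x :=
  ((isSmoothFieldOn_coordField he u x hx).contMDiffAt
    (e.open_source.mem_nhds hx)).mdifferentiableAt (by simp)

variable {D : AffineConnection n M}

theorem D_sum_smul_coordField (he : e ∈ IsManifold.maximalAtlas (𝓡 n) ∞ M) {x : M}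
    (hx : x ∈ e.source) {ι : Type*} (s : Finset ι) {g : ι → M → ℝ}
    (hg : ∀ i, MDifferentiableAt (𝓡 n) 𝓘(ℝ, ℝ) (g i) x) (u : ι → EuclideanSpace ℝ (Fin n))
    (v : TangentSpace (𝓡 n) x) :
    D (∑ i ∈ s, g i • coordField e (u i)) x v
      = ∑ i ∈ s, (g i x • D (coordField e (u i)) x v
          + mvfderiv (𝓡 n) (g i) x v • coordField e (u i) x) := by
  have hd (s : Finset ι) : MDifferentiableAt (𝓡 n) (𝓡 n).tangent
      (fun x ↦ (⟨x, (∑ i ∈ s, g i • coordField e (u i)) x⟩ : TangentBundle (𝓡 n) M)) x := by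
    have := MDifferentiableAt.sum_section (s := s) (fun i _ ↦
      MDifferentiableAt.smul_section (hg i) (mdifferentiableAt_coordField he (u i) hx))
    convert this using 2
    simp
  classical
  induction s using Finset.induction_on with
  | empty => simp
  | insert i s hi ih =>
    rw [Finset.sum_insert hi, Finset.sum_insert hi, D.isCovariantDerivativeOnUniv.add
      (MDifferentiableAt.smul_section (hg i) (mdifferentiableAt_coordField he (u i) hx)) (hd s),
      add_apply, ih, D.isCovariantDerivativeOnUniv.leibniz
        (mdifferentiableAt_coordField he (u i) hx) (hg i)]
    rfl

/-- The Christoffel symbols as a bilinear map depending on the coordinates. -/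
def christoffelMap (D : AffineConnection n M)
    (e : OpenPartialHomeomorph M (EuclideanSpace ℝ (Fin n))) (y : EuclideanSpace ℝ (Fin n)) :
    EuclideanSpace ℝ (Fin n) →L[ℝ] EuclideanSpace ℝ (Fin n) →L[ℝ] EuclideanSpace ℝ (Fin n) :=
  ∑ i, ∑ j, (EuclideanSpace.proj (𝕜 := ℝ) i).smulRight
    ((EuclideanSpace.proj (𝕜 := ℝ) j).smulRight
      (christoffel D e y (EuclideanSpace.single i 1) (EuclideanSpace.single j 1)))

theorem christoffelMap_apply (y u v : EuclideanSpace ℝ (Fin n)) :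
    christoffelMap D e y u v = ∑ i, ∑ j, u i • v j •
      christoffel D e y (EuclideanSpace.single i 1) (EuclideanSpace.single j 1) := by
  simp [christoffelMap]

/-- The covariant derivative in coordinates. -/
theorem components_D_chartField (he : e ∈ IsManifold.maximalAtlas (𝓡 n) ∞ M)
    {F : EuclideanSpace ℝ (Fin n) → EuclideanSpace ℝ (Fin n)} {x : M} (hx : x ∈ e.source)
    (hF : DifferentiableAt ℝ F (e x)) (v : TangentSpace (𝓡 n) x) :
    components e x (D (chartField e F) x v)
      = fderiv ℝ F (e x) (components e x v)
        + christoffelMap D e (e x) (components e x v) (F (e x)) := by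
  have hFi (i : Fin n) : DifferentiableAt ℝ (fun y ↦ F y i) (e x) :=
    (EuclideanSpace.proj (𝕜 := ℝ) i).differentiableAt.comp (e x) hF
  have hdF (i : Fin n) (u : EuclideanSpace ℝ (Fin n)) :
      fderiv ℝ (fun y ↦ F y i) (e x) u = fderiv ℝ F (e x) u i := by
    have := ((EuclideanSpace.proj (𝕜 := ℝ) i).hasFDerivAt.comp (e x) hF.hasFDerivAt).fderiv
    exact congrArg (fun L ↦ L u) this
  have hg (i : Fin n) : MDifferentiableAt (𝓡 n) 𝓘(ℝ, ℝ) (fun x ↦ F (e x) i) x :=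
    mdifferentiableAt_comp_chart (G := fun y ↦ F y i) he hx (hFi i)
  rw [chartField_eq_sum, D_sum_smul_coordField he hx _ hg, components_sum]
  simp only [components_add, components_smul, Finset.sum_add_distrib, components_coordField he hx]
  rw [add_comm]
  congr 1
  · conv_rhs => rw [← (EuclideanSpace.basisFun (Fin n) ℝ).sum_repr
      (fderiv ℝ F (e x) (components e x v))]
    refine Finset.sum_congr rfl fun i _ ↦ ?_
    rw [mvfderiv_of_eventuallyEq (G := fun y ↦ F y i) he hx (hFi i) (fun _ _ ↦ rfl), hdF]
    simp
  · rw [christoffelMap_apply, Finset.sum_comm]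
    refine Finset.sum_congr rfl fun j _ ↦ ?_
    have hv : v = ∑ i, components e x v i • coordField e (EuclideanSpace.single i 1) x := by
      conv_lhs => rw [← coordField_components he hx v,
        ← (EuclideanSpace.basisFun (Fin n) ℝ).sum_repr (components e x v), coordField_sum]
      refine Finset.sum_congr rfl fun i _ ↦ ?_
      rw [coordField_smul]
      simp
    conv_lhs => rw [hv]
    rw [map_sum, components_sum, Finset.smul_sum]
    refine Finset.sum_congr rfl fun i _ ↦ ?_
    rw [map_smul, components_smul, christoffel, e.left_inv hx, nabla, smul_comm]

/-- Bilinearity is not built into `christoffel`: it holds on the target, by differentiating fields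
with constant components. `christoffelMap` is bilinear everywhere and can be differentiated as a map
into bilinear maps. -/
theorem christoffel_eq (he : e ∈ IsManifold.maximalAtlas (𝓡 n) ∞ M)
    {y : EuclideanSpace ℝ (Fin n)} (hy : y ∈ e.target) (u v : EuclideanSpace ℝ (Fin n)) :
    christoffel D e y u v = christoffelMap D e y u v := by
  have hx := e.map_target hy
  rw [christoffel, nabla, coordField_eq_chartField v,
    components_D_chartField he hx (differentiableAt_const v), components_coordField he hx,
    e.right_inv hy]
  simp

theorem analyticOnNhd_christoffelMap
    (h : ∀ u v : EuclideanSpace ℝ (Fin n),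
      AnalyticOnNhd ℝ (fun y ↦ christoffel D e y u v) e.target) :
    AnalyticOnNhd ℝ (christoffelMap D e) e.target := by
  intro y hy
  refine ContDiffAt.analyticAt ?_
  refine ContDiffAt.sum fun i _ ↦ ContDiffAt.sum fun j _ ↦ ?_
  exact contDiffAt_const.smulRight (contDiffAt_const.smulRight (h _ _ y hy).contDiffAt)

end Charts

/-! ### Brackets, curvature and torsion in coordinates. -/

section Coordinates

variable {n : ℕ} {M : Type*} [TopologicalSpace M] [ChartedSpace (EuclideanSpace ℝ (Fin n)) M]
  {e : OpenPartialHomeomorph M (EuclideanSpace ℝ (Fin n))}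

/-- The function `F` of the coordinates gives the components of the vector field `X` in the
chart `e`. -/
def HasComponents (e : OpenPartialHomeomorph M (EuclideanSpace ℝ (Fin n)))
    (X : Π x : M, TangentSpace (𝓡 n) x)
    (F : EuclideanSpace ℝ (Fin n) → EuclideanSpace ℝ (Fin n)) : Prop :=
  ∀ x ∈ e.source, components e x (X x) = F (e x)

theorem hasComponents_coordField (he : e ∈ IsManifold.maximalAtlas (𝓡 n) ∞ M)
    (u : EuclideanSpace ℝ (Fin n)) : HasComponents (M := M) e (coordField e u) (fun _ ↦ u) :=
  fun _ hx ↦ components_coordField he hx u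

theorem HasComponents.eq_chartField (he : e ∈ IsManifold.maximalAtlas (𝓡 n) ∞ M)
    {X : Π x : M, TangentSpace (𝓡 n) x}
    {F : EuclideanSpace ℝ (Fin n) → EuclideanSpace ℝ (Fin n)} (h : HasComponents e X F) {x : M}
    (hx : x ∈ e.source) : X x = chartField e F x := by
  rw [chartField, ← h x hx, coordField_components he hx]

variable [IsManifold (𝓡 n) ∞ M] {D : AffineConnection n M}
  {X Y Z : Π x : M, TangentSpace (𝓡 n) x}
  {F G H : EuclideanSpace ℝ (Fin n) → EuclideanSpace ℝ (Fin n)}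

theorem mdifferentiableAt_chartField (he : e ∈ IsManifold.maximalAtlas (𝓡 n) ∞ M) {x : M}
    (hx : x ∈ e.source) (hF : DifferentiableAt ℝ F (e x)) :
    MDifferentiableAt (𝓡 n) (𝓡 n).tangent
      (fun x ↦ (⟨x, chartField e F x⟩ : TangentBundle (𝓡 n) M)) x := by
  have hg (i : Fin n) : MDifferentiableAt (𝓡 n) 𝓘(ℝ, ℝ) (fun x ↦ F (e x) i) x :=
    mdifferentiableAt_comp_chart (G := fun y ↦ F y i) he hx
      ((EuclideanSpace.proj (𝕜 := ℝ) i).differentiableAt.comp (e x) hF)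
  have := MDifferentiableAt.sum_section (s := Finset.univ) (fun i _ ↦
    MDifferentiableAt.smul_section (hg i)
      (mdifferentiableAt_coordField he (EuclideanSpace.single i 1) hx))
  rw [chartField_eq_sum]
  convert this using 2
  simp

theorem HasComponents.mdifferentiableAt (he : e ∈ IsManifold.maximalAtlas (𝓡 n) ∞ M)
    (h : HasComponents e X F) {x : M} (hx : x ∈ e.source) (hF : DifferentiableAt ℝ F (e x)) :
    MDifferentiableAt (𝓡 n) (𝓡 n).tangent (fun x ↦ (⟨x, X x⟩ : TangentBundle (𝓡 n) M)) x := by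
  refine (mdifferentiableAt_chartField he hx hF).congr_of_eventuallyEq ?_
  filter_upwards [e.open_source.mem_nhds hx] with z hz
  rw [h.eq_chartField he hz]

theorem HasComponents.components_D (he : e ∈ IsManifold.maximalAtlas (𝓡 n) ∞ M)
    (h : HasComponents e X F) {x : M} (hx : x ∈ e.source) (hF : DifferentiableAt ℝ F (e x))
    (v : TangentSpace (𝓡 n) x) :
    components e x (D X x v) = fderiv ℝ F (e x) (components e x v)
      + christoffelMap D e (e x) (components e x v) (F (e x)) := by
  rw [← components_D_chartField he hx hF, D.isCovariantDerivativeOn.congr_of_eqOn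
    (h.mdifferentiableAt he hx hF) (mdifferentiableAt_chartField he hx hF)
    (e.open_source.mem_nhds hx) (fun z hz ↦ h.eq_chartField he hz)]

theorem HasComponents.nabla (he : e ∈ IsManifold.maximalAtlas (𝓡 n) ∞ M)
    (hX : HasComponents e X F) (hY : HasComponents e Y G)
    (hG : ∀ y ∈ e.target, DifferentiableAt ℝ G y) :
    HasComponents e (nabla D X Y)
      (fun y ↦ fderiv ℝ G y (F y) + christoffelMap D e y (F y) (G y)) := by
  intro x hx
  rw [Fedosov.nabla, hY.components_D he hx (hG _ (e.map_source hx)), hX x hx]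

/-- On the chart domain X and Y are pullbacks of F and G, and the Lie bracket commutes with
pullback. -/
theorem HasComponents.mlieBracket (he : e ∈ IsManifold.maximalAtlas (𝓡 n) ∞ M)
    (hX : HasComponents e X F) (hY : HasComponents e Y G)
    (hF : ∀ y ∈ e.target, DifferentiableAt ℝ F y) (hG : ∀ y ∈ e.target, DifferentiableAt ℝ G y) :
    HasComponents e (VectorField.mlieBracket (𝓡 n) X Y)
      (fun y ↦ fderiv ℝ G y (F y) - fderiv ℝ F y (G y)) := by
  intro x hx
  have hmd (F : EuclideanSpace ℝ (Fin n) → EuclideanSpace ℝ (Fin n))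
      (hF : DifferentiableAt ℝ F (e x)) :
      MDifferentiableAt 𝓘(ℝ, EuclideanSpace ℝ (Fin n)) 𝓘(ℝ, EuclideanSpace ℝ (Fin n)).tangent
        (fun y ↦ (⟨y, F y⟩ : TangentBundle 𝓘(ℝ, EuclideanSpace ℝ (Fin n))
          (EuclideanSpace ℝ (Fin n)))) (e x) := by
    rw [mdifferentiableAt_totalSpace]
    exact ⟨mdifferentiableAt_id, by simpa using! hF.mdifferentiableAt⟩
  have h1 : VectorField.mlieBracket (𝓡 n) X Y x
      = VectorField.mlieBracket (𝓡 n) (chartField e F) (chartField e G) x :=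
    Filter.EventuallyEq.mlieBracket_vectorField_eq
      (by filter_upwards [e.open_source.mem_nhds hx] with z hz using hX.eq_chartField he hz)
      (by filter_upwards [e.open_source.mem_nhds hx] with z hz using hY.eq_chartField he hz)
  have h2le : minSmoothness ℝ 2 ≤ (∞ : WithTop ℕ∞) := by
    rw [minSmoothness_of_isRCLikeNormedField]
    exact ENat.LEInfty.out
  have : IsManifold (𝓡 n) (minSmoothness ℝ 2) M := IsManifold.of_le h2le
  have h2 := VectorField.mpullback_mlieBracket (I := 𝓡 n)
    (I' := 𝓘(ℝ, EuclideanSpace ℝ (Fin n))) (n := ∞) (f := e) (x₀ := x)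
    (hmd F (hF _ (e.map_source hx))) (hmd G (hG _ (e.map_source hx)))
    (contMDiffAt_of_mem_maximalAtlas he hx) h2le
  have h3 : VectorField.mlieBracket 𝓘(ℝ, EuclideanSpace ℝ (Fin n)) F G (e x)
      = VectorField.lieBracket ℝ F G (e x) := by
    have h4 := congrFun (VectorField.mlieBracketWithin_eq_lieBracketWithin (𝕜 := ℝ) (V := F) (W := G)
      (s := univ)) (e x)
    refine Eq.trans ?_ (h4.trans (by rw [VectorField.lieBracketWithin_univ]))
    exact (congrFun (VectorField.mlieBracketWithin_univ
      (I := 𝓘(ℝ, EuclideanSpace ℝ (Fin n))) (V := F) (W := G)) (e x)).symm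
  rw [h1, chartField_eq_mpullback, chartField_eq_mpullback, ← h2]
  exact (components_coordField he hx
    (VectorField.mlieBracket 𝓘(ℝ, EuclideanSpace ℝ (Fin n)) F G (e x))).trans h3

/-- The curvature in coordinates. -/
theorem HasComponents.components_curvature (he : e ∈ IsManifold.maximalAtlas (𝓡 n) ∞ M)
    (hΓ : AnalyticOnNhd ℝ (christoffelMap D e) e.target)
    (hX : HasComponents e X F) (hY : HasComponents e Y G) (hZ : HasComponents e Z H)
    (hF : AnalyticOnNhd ℝ F e.target) (hG : AnalyticOnNhd ℝ G e.target)
    (hH : AnalyticOnNhd ℝ H e.target) {x : M} (hx : x ∈ e.source) :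
    components e x (curvature D X Y Z x) =
      curvatureOfChristoffel (christoffelMap D e) (e x) (F (e x)) (G (e x)) (H (e x)) := by
  have hy := e.map_source hx
  have hdF := fun y hy ↦ (hF y hy).differentiableAt
  have hdG := fun y hy ↦ (hG y hy).differentiableAt
  have hdH := fun y hy ↦ (hH y hy).differentiableAt
  -- Differential of the components of ∇_F H. It serves both orders of differentiation; the second
  -- derivatives of H then cancel by symmetry, and the terms in DF, DG against the bracket.
  have key (F : EuclideanSpace ℝ (Fin n) → EuclideanSpace ℝ (Fin n))
      (hF : AnalyticOnNhd ℝ F e.target) (v : EuclideanSpace ℝ (Fin n)) :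
      DifferentiableAt ℝ (fun y ↦ fderiv ℝ H y (F y) + christoffelMap D e y (F y) (H y)) (e x) ∧
      fderiv ℝ (fun y ↦ fderiv ℝ H y (F y) + christoffelMap D e y (F y) (H y)) (e x) v
        = fderiv ℝ (fderiv ℝ H) (e x) v (F (e x)) + fderiv ℝ H (e x) (fderiv ℝ F (e x) v)
          + (fderiv ℝ (christoffelMap D e) (e x) v (F (e x)) (H (e x))
            + christoffelMap D e (e x) (fderiv ℝ F (e x) v) (H (e x))
            + christoffelMap D e (e x) (F (e x)) (fderiv ℝ H (e x) v)) := by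
    have d1 := (hH _ hy).fderiv.differentiableAt.hasFDerivAt
    have d2 := (hF _ hy).differentiableAt.hasFDerivAt
    have d3 := (hΓ _ hy).differentiableAt.hasFDerivAt
    have d4 := (hH _ hy).differentiableAt.hasFDerivAt
    have d5 := (d1.clm_apply d2).add ((d3.clm_apply d2).clm_apply d4)
    refine ⟨d5.differentiableAt, ?_⟩
    rw [show fderiv ℝ (fun y ↦ fderiv ℝ H y (F y) + christoffelMap D e y (F y) (H y)) (e x) = _
      from d5.fderiv]
    simp only [add_apply, ContinuousLinearMap.comp_apply, ContinuousLinearMap.flip_apply]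
    abel
  have hYZ := hY.nabla (D := D) he hZ hdH
  have hXZ := hX.nabla (D := D) he hZ hdH
  have hXY := hX.mlieBracket he hY hdF hdG
  have hsymm : fderiv ℝ (fderiv ℝ H) (e x) (F (e x)) (G (e x))
      = fderiv ℝ (fderiv ℝ H) (e x) (G (e x)) (F (e x)) :=
    (ContDiffAt.isSymmSndFDerivAt_of_omega (hH _ hy).contDiffAt).eq _ _
  rw [curvature, components_sub, components_sub, Fedosov.nabla, Fedosov.nabla, Fedosov.nabla,
    hYZ.components_D he hx (key G hG 0).1, hXZ.components_D he hx (key F hF 0).1,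
    hZ.components_D he hx (hdH _ hy), (key G hG _).2, (key F hF _).2, hXY x hx, hX x hx, hY x hx,
    hsymm, curvatureOfChristoffel]
  simp only [map_add, map_sub, sub_apply]
  abel

/-- Coordinate fields with constant components commute. -/
theorem christoffelMap_symm (he : e ∈ IsManifold.maximalAtlas (𝓡 n) ∞ M) (hD : IsTorsionFree D)
    {y : EuclideanSpace ℝ (Fin n)} (hy : y ∈ e.target) (u v : EuclideanSpace ℝ (Fin n)) :
    christoffelMap D e y u v = christoffelMap D e y v u := by
  have hx := e.map_target hy
  have hu := hasComponents_coordField he u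
  have hv := hasComponents_coordField he v
  have hc (u : EuclideanSpace ℝ (Fin n)) : ∀ y ∈ e.target,
      DifferentiableAt ℝ (fun _ : EuclideanSpace ℝ (Fin n) ↦ u) y :=
    fun _ _ ↦ differentiableAt_const u
  have h := hD e.source e.open_source _ _ (isSmoothFieldOn_coordField he u)
    (isSmoothFieldOn_coordField he v) (e.symm y) hx
  have h' := congrArg (components e (e.symm y)) h
  rw [components_sub, hu.nabla he hv (hc v) _ hx, hv.nabla he hu (hc u) _ hx,
    hu.mlieBracket he hv (hc u) (hc v) _ hx, e.right_inv hy] at h'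
  simpa [sub_eq_zero] using h'

end Coordinates

/-! ### Ricci curvature and the symplectic form of a surface in a chart. -/

section Surface

variable {M : Type*} [TopologicalSpace M] [ChartedSpace Plane M] [IsManifold (𝓡 2) ∞ M]
  {e : OpenPartialHomeomorph M Plane} {D : AffineConnection 2 M}
  {Ω : Π x : M, TangentSpace (𝓡 2) x →L[ℝ] TangentSpace (𝓡 2) x →L[ℝ] ℝ}

/-- The trace of V ↦ σ(Y,V) AZ is σ(Y, AZ). -/
theorem ricci_eq (he : e ∈ IsManifold.maximalAtlas (𝓡 2) ∞ M)
    (hΓ : AnalyticOnNhd ℝ (christoffelMap D e) e.target)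
    {Y Z : Π x : M, TangentSpace (𝓡 2) x} {F H : Plane → Plane}
    (hY : HasComponents e Y F) (hZ : HasComponents e Z H)
    (hF : AnalyticOnNhd ℝ F e.target) (hH : AnalyticOnNhd ℝ H e.target)
    {x : M} (hx : x ∈ e.source) :
    ricci D e Y Z x
      = areaForm (F (e x)) (curvatureOperator (christoffelMap D e) (e x) (H (e x))) := by
  have h (i : Fin 2) := hY.components_curvature he hΓ
    (hasComponents_coordField he (EuclideanSpace.single i 1)) hZ hF analyticOnNhd_const hH hx
  rw [ricci, Fin.sum_univ_two, h, h, curvatureOfChristoffel_eq, curvatureOfChristoffel_eq]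
  simp [areaForm_apply]
  ring

/-- With X = Y = Z a field of constant components, the three terms of the cyclic sum coincide; this
diagonal case is all that constancy of r(c',c') along geodesics requires. -/
theorem IsPreferred.cyclic_coordinates (hD : IsPreferred Ω D)
    (he : e ∈ IsManifold.maximalAtlas (𝓡 2) ∞ M)
    (hΓ : AnalyticOnNhd ℝ (christoffelMap D e) e.target) {y : Plane} (hy : y ∈ e.target)
    (u : Plane) :
    areaForm u (fderiv ℝ (curvatureOperator (christoffelMap D e)) y u u)
      - areaForm (christoffelMap D e y u u) (curvatureOperator (christoffelMap D e) y u)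
      - areaForm u (curvatureOperator (christoffelMap D e) y (christoffelMap D e y u u)) = 0 := by
  have hx := e.map_target hy
  have hs := isSmoothFieldOn_coordField he u
  have h := hD.cyclic e he _ _ _ hs hs hs _ hx
  have hu := hasComponents_coordField he u
  have huu : HasComponents e (nabla D (coordField e u) (coordField e u))
      (fun y ↦ christoffelMap D e y u u) := by
    intro x hx
    have := hu.nabla (D := D) he hu (fun _ _ ↦ differentiableAt_const u) x hx
    simpa using this
  have hΓu : AnalyticOnNhd ℝ (fun y ↦ christoffelMap D e y u u) e.target := fun y hy ↦
    (((hΓ y hy).contDiffAt (n := ω)).clm_apply contDiffAt_const |>.clm_apply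
      contDiffAt_const).analyticAt
  have hA := (differentiableAt_curvatureOperator (hΓ y hy)).hasFDerivAt
  have hG := (hasFDerivAt_const (areaForm u) y).clm_apply (hA.clm_apply (hasFDerivAt_const u y))
  have hm := mvfderiv_of_eventuallyEq (g := ricci D e (coordField e u) (coordField e u))
    (G := fun y ↦ areaForm u (curvatureOperator (christoffelMap D e) y u)) he hx
    (by rw [e.right_inv hy]; exact hG.differentiableAt)
    (fun z hz ↦ ricci_eq he hΓ hu hu analyticOnNhd_const analyticOnNhd_const hz)
    (coordField e u (e.symm y))
  rw [nablaRicci, hm, ricci_eq he hΓ huu hu hΓu analyticOnNhd_const hx,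
    ricci_eq he hΓ hu huu analyticOnNhd_const hΓu hx, components_coordField he hx,
    e.right_inv hy, HasFDerivAt.fderiv hG] at h
  simp only [add_apply, ContinuousLinearMap.comp_apply, ContinuousLinearMap.flip_apply,
    zero_apply, map_zero, add_zero] at h
  simp only [zero_add] at h
  linarith

/-- A two-form in the chart `e`. -/
def formMap (Ω : Π x : M, TangentSpace (𝓡 2) x →L[ℝ] TangentSpace (𝓡 2) x →L[ℝ] ℝ)
    (e : OpenPartialHomeomorph M Plane) (y : Plane) : Plane →L[ℝ] Plane →L[ℝ] ℝ :=
  Ω (e.symm y) (coordField e (EuclideanSpace.single 0 1) (e.symm y))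
    (coordField e (EuclideanSpace.single 1 1) (e.symm y)) • areaForm

theorem formMap_components (hΩ : IsSymplecticForm Ω)
    (he : e ∈ IsManifold.maximalAtlas (𝓡 2) ∞ M) {x : M} (hx : x ∈ e.source)
    (u v : TangentSpace (𝓡 2) x) :
    formMap Ω e (e x) (components e x u) (components e x v) = Ω x u v := by
  have halt (u v : TangentSpace (𝓡 2) x) : Ω x u v = -Ω x v u := by
    have h1 := hΩ.alternating x (u + v)
    simp only [map_add, add_apply, hΩ.alternating x u, hΩ.alternating x v] at h1
    linarith
  have h := eq_areaForm_smul (fun a b : Plane ↦ Ω x (coordField e a x) (coordField e b x))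
    (fun a a' b ↦ by simp only [coordField_add, map_add, add_apply])
    (fun c a b ↦ by simp only [coordField_smul, map_smul, smul_apply])
    (fun a b ↦ halt _ _) (components e x u) (components e x v)
  simp only [coordField_components he hx] at h
  rw [h, formMap, e.left_inv hx, smul_apply, smul_apply, smul_eq_mul, smul_eq_mul, mul_comm]

theorem formMap_apply (hΩ : IsSymplecticForm Ω) (he : e ∈ IsManifold.maximalAtlas (𝓡 2) ∞ M)
    {x : M} (hx : x ∈ e.source) (u v : Plane) :
    formMap Ω e (e x) u v = Ω x (coordField e u x) (coordField e v x) := by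
  rw [← formMap_components hΩ he hx, components_coordField he hx, components_coordField he hx]

/-- The area form is constant, so only the scalar coefficient, the value of Ω on the frame, has to
be differentiable. -/
theorem differentiableAt_formMap (hΩ : IsSymplecticForm Ω)
    (he : e ∈ IsManifold.maximalAtlas (𝓡 2) ∞ M) {y : Plane} (hy : y ∈ e.target) :
    DifferentiableAt ℝ (formMap Ω e) y := by
  have hx := e.map_target hy
  have hc (u : Plane) := (isSmoothFieldOn_coordField he u _ hx).contMDiffAt
    (e.open_source.mem_nhds hx)
  have h1 : ContMDiffAt (𝓡 2) ((𝓡 2).prod 𝓘(ℝ, ℝ)) ∞ (fun x ↦ Bundle.TotalSpace.mk' ℝ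
      (E := Bundle.Trivial M ℝ) x (Ω x (coordField e (EuclideanSpace.single 0 1) x)
        (coordField e (EuclideanSpace.single 1 1) x))) (e.symm y) :=
    ContMDiffAt.clm_bundle_apply₂ (E₃ := Bundle.Trivial M ℝ) (hΩ.smooth _) (hc _) (hc _)
  have h2 : ContMDiffAt (𝓡 2) 𝓘(ℝ, ℝ) ∞ (fun x ↦ Ω x (coordField e (EuclideanSpace.single 0 1) x)
        (coordField e (EuclideanSpace.single 1 1) x)) (e.symm y) :=
    (Bundle.contMDiffAt_section _).1 h1
  have h3 := (h2.mdifferentiableAt (by simp)).comp y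
    ((chart_mdifferentiable he).mdifferentiableAt_symm hy)
  have h4 : DifferentiableAt ℝ (fun y ↦ Ω (e.symm y)
      (coordField e (EuclideanSpace.single 0 1) (e.symm y))
      (coordField e (EuclideanSpace.single 1 1) (e.symm y))) y :=
    mdifferentiableAt_iff_differentiableAt.1 h3
  exact DifferentiableAt.comp (G := Plane →L[ℝ] Plane →L[ℝ] ℝ) y
    (ContinuousLinearMap.differentiableAt (F := Plane →L[ℝ] Plane →L[ℝ] ℝ)
      (ContinuousLinearMap.toSpanSingleton ℝ areaForm)) h4

theorem formMap_parallel (hΩ : IsSymplecticForm Ω) (hD : IsSymplecticConnection Ω D)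
    (he : e ∈ IsManifold.maximalAtlas (𝓡 2) ∞ M) {y : Plane} (hy : y ∈ e.target) (u a b : Plane) :
    fderiv ℝ (formMap Ω e) y u a b = formMap Ω e y (christoffelMap D e y u a) b
      + formMap Ω e y a (christoffelMap D e y u b) := by
  have hx := e.map_target hy
  have h := hD.parallel e.source e.open_source _ _ _ (isSmoothFieldOn_coordField he u)
    (isSmoothFieldOn_coordField he a) (isSmoothFieldOn_coordField he b) _ hx
  have hG := ((differentiableAt_formMap hΩ he hy).hasFDerivAt.clm_apply
    (hasFDerivAt_const a y)).clm_apply (hasFDerivAt_const b y)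
  rw [mvfderiv_of_eventuallyEq (G := fun y ↦ formMap Ω e y a b) he hx
    (by rw [e.right_inv hy]; exact hG.differentiableAt)
    (fun z hz ↦ (formMap_apply hΩ he hz a b).symm), components_coordField he hx,
    ← formMap_components hΩ he hx, ← formMap_components hΩ he hx, e.right_inv hy,
    HasFDerivAt.fderiv hG] at h
  have hc (v : Plane) : components e (e.symm y) (nabla D (coordField e u) (coordField e v)
      (e.symm y)) = christoffelMap D e y u v :=
    christoffel_eq he hy u v
  rw [hc, hc, components_coordField he hx, components_coordField he hx] at h
  simpa using h

end Surface

/-! ### Invariance of the geodesic equation, which `IsGeodesicOn` demands in every chart. -/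

section ChangeOfChart

variable {n : ℕ} {M : Type*} [TopologicalSpace M] [ChartedSpace (EuclideanSpace ℝ (Fin n)) M]
  {e e' : OpenPartialHomeomorph M (EuclideanSpace ℝ (Fin n))}

/-- The change of coordinates from `e` to `e'` is smooth. -/
theorem contDiffAt_transition (he : e ∈ IsManifold.maximalAtlas (𝓡 n) ∞ M)
    (he' : e' ∈ IsManifold.maximalAtlas (𝓡 n) ∞ M) {x : M} (hx : x ∈ e.source)
    (hx' : x ∈ e'.source) : ContDiffAt ℝ ∞ (e' ∘ e.symm) (e x) := by
  refine ContMDiffAt.contDiffAt ?_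
  have h1 := contMDiffAt_of_mem_maximalAtlas he' hx'
  have h2 := contMDiffAt_symm_of_mem_maximalAtlas he (e.map_source hx)
  exact ContMDiffAt.comp (e x) (by rwa [e.left_inv hx]) h2

theorem components_transition (he : e ∈ IsManifold.maximalAtlas (𝓡 n) ∞ M)
    (he' : e' ∈ IsManifold.maximalAtlas (𝓡 n) ∞ M) {x : M} (hx : x ∈ e.source)
    (hx' : x ∈ e'.source) (w : TangentSpace (𝓡 n) x) :
    components e' x w = fderiv ℝ (e' ∘ e.symm) (e x) (components e x w) := by
  have h1 := (((contDiffAt_transition he he' hx hx').differentiableAt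
    (by simp)).hasFDerivAt).hasMFDerivAt.comp x
      ((chart_mdifferentiable he).mdifferentiableAt hx).hasMFDerivAt
  have h2 := h1.congr_of_eventuallyEq (f₁ := e') (by
    filter_upwards [e.open_source.mem_nhds hx] with z hz
    simp [e.left_inv hz])
  rw [components, h2.mfderiv]
  rfl

variable [IsManifold (𝓡 n) ∞ M] {D : AffineConnection n M}

/-- The transformation law of Christoffel symbols. -/
theorem christoffelMap_transition (he : e ∈ IsManifold.maximalAtlas (𝓡 n) ∞ M)
    (he' : e' ∈ IsManifold.maximalAtlas (𝓡 n) ∞ M) {x : M} (hx : x ∈ e.source)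
    (hx' : x ∈ e'.source) (a b : EuclideanSpace ℝ (Fin n)) :
    christoffelMap D e' (e' x) (fderiv ℝ (e' ∘ e.symm) (e x) a)
        (fderiv ℝ (e' ∘ e.symm) (e x) b)
      = fderiv ℝ (e' ∘ e.symm) (e x) (christoffelMap D e (e x) a b)
        - fderiv ℝ (fderiv ℝ (e' ∘ e.symm)) (e x) a b := by
  set τ := e' ∘ e.symm with hτ
  set w := coordField e a x
  set v := fderiv ℝ τ (e x) b with hv
  -- F gives the components in e of the field with constant components v in e'. The law results from
  -- computing its covariant derivative in both charts.
  let F : EuclideanSpace ℝ (Fin n) → EuclideanSpace ℝ (Fin n) :=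
    fun y ↦ fderiv ℝ (e ∘ e'.symm) (τ y) v
  have hτx : τ (e x) = e' x := by simp [hτ, e.left_inv hx]
  have hτd := contDiffAt_transition he he' hx hx'
  have hσd := contDiffAt_transition he' he hx' hx
  have hF : DifferentiableAt ℝ F (e x) := by
    have h1 : DifferentiableAt ℝ (fderiv ℝ (e ∘ e'.symm)) (τ (e x)) := by
      rw [hτx]
      exact (hσd.fderiv_right (m := 1) (by norm_cast)).differentiableAt (by simp)
    exact (h1.comp (e x) (hτd.differentiableAt (by simp))).clm_apply (differentiableAt_const v)
  have hO : ∀ᶠ z in 𝓝 x, z ∈ e.source ∧ z ∈ e'.source :=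
    Filter.Eventually.and (e.open_source.mem_nhds hx) (e'.open_source.mem_nhds hx')
  have hcomp (z : M) (hz : z ∈ e.source) (hz' : z ∈ e'.source) :
      components e z (coordField e' v z) = F (e z) := by
    rw [components_transition he' he hz' hz, components_coordField he' hz']
    simp [F, hτ, e.left_inv hz]
  have hfield : ∀ᶠ z in 𝓝 x, coordField e' v z = chartField e F z := by
    filter_upwards [hO] with z hz
    rw [chartField, ← hcomp z hz.1 hz.2, coordField_components he hz.1]
  have hD : D (coordField e' v) x w = D (chartField e F) x w := by
    rw [D.isCovariantDerivativeOn.congr_of_eventuallyEq (s := univ)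
      (mdifferentiableAt_coordField he' v hx') (mdifferentiableAt_chartField he hx hF)
      univ_mem hfield]
  have hFx : F (e x) = b := by
    rw [← hcomp x hx hx', hv, ← components_coordField he hx b,
      ← components_transition he he' hx hx', coordField_components he' hx',
      components_coordField he hx]
  have hcw : components e x w = a := components_coordField he hx a
  have hD1 := components_D_chartField (D := D) he hx hF w
  have hD2 := components_D_chartField (D := D) (F := fun _ ↦ v) he' hx'
    (differentiableAt_const v) w
  rw [← coordField_eq_chartField, hD, components_transition he he' hx hx', hD1,
    components_transition he he' hx hx' w, hcw, hFx] at hD2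
  -- Differentiating Dτ(y) F(y) = v trades the derivative of F for the second derivative of τ.
  have hinv : fderiv ℝ (fderiv ℝ τ) (e x) a b + fderiv ℝ τ (e x) (fderiv ℝ F (e x) a) = 0 := by
    have h1 : DifferentiableAt ℝ (fderiv ℝ τ) (e x) :=
      (hτd.fderiv_right (m := 1) (by norm_cast)).differentiableAt (by simp)
    have h2 := h1.hasFDerivAt.clm_apply hF.hasFDerivAt
    have h3 : (fun y ↦ fderiv ℝ τ y (F y)) =ᶠ[𝓝 (e x)] fun _ ↦ v := by
      have : ∀ᶠ y in 𝓝 (e x), e.symm y ∈ e.source ∧ e.symm y ∈ e'.source :=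
        (e.symm.continuousAt (e.map_source hx)).eventually (by rw [e.left_inv hx]; exact hO)
      filter_upwards [this, e.open_target.mem_nhds (e.map_source hx)] with y hy hyt
      have h4 := hcomp _ hy.1 hy.2
      rw [e.right_inv hyt] at h4
      rw [← h4]
      have h5 := components_transition he he' hy.1 hy.2 (coordField e' v (e.symm y))
      rw [e.right_inv hyt, components_coordField he' hy.2] at h5
      exact h5.symm
    have h6 := h2.unique ((hasFDerivAt_const v (e x)).congr_of_eventuallyEq h3)
    have h7 := congrArg (fun L ↦ L a) h6
    simp only [add_apply, ContinuousLinearMap.comp_apply, ContinuousLinearMap.flip_apply,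
      zero_apply, hFx] at h7
    rw [add_comm]
    exact h7
  simp only [map_add] at hD2
  have h0 : fderiv ℝ (fun _ : EuclideanSpace ℝ (Fin n) ↦ v) (e' x) = 0 := by simp
  rw [h0] at hD2
  simp only [zero_apply, zero_add] at hD2
  rw [← hD2, eq_neg_of_add_eq_zero_right hinv]
  abel

/-- A curve satisfying the geodesic equation in one chart satisfies it in every chart. -/
theorem geodesic_equation_transition (he : e ∈ IsManifold.maximalAtlas (𝓡 n) ∞ M)
    (he' : e' ∈ IsManifold.maximalAtlas (𝓡 n) ∞ M) {c c₁ : ℝ → EuclideanSpace ℝ (Fin n)}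
    {c₂ : EuclideanSpace ℝ (Fin n)} {t : ℝ} (ht : c t ∈ e.target)
    (ht' : e.symm (c t) ∈ e'.source) (hc : ∀ᶠ s in 𝓝 t, HasDerivAt c (c₁ s) s)
    (hc₁ : HasDerivAt c₁ c₂ t) (hgeo : c₂ + christoffelMap D e (c t) (c₁ t) (c₁ t) = 0) :
    deriv (deriv (e' ∘ (e.symm ∘ c))) t
      + christoffel D e' (e' (e.symm (c t))) (deriv (e' ∘ (e.symm ∘ c)) t)
        (deriv (e' ∘ (e.symm ∘ c)) t) = 0 := by
  set τ := e' ∘ e.symm with hτ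
  have hcc : ContinuousAt c t := hc.self_of_nhds.continuousAt
  have hτd (y : EuclideanSpace ℝ (Fin n)) (hy : y ∈ e.target) (hy' : e.symm y ∈ e'.source) :
      ContDiffAt ℝ ∞ τ y := by
    have := contDiffAt_transition he he' (e.map_target hy) hy'
    rwa [e.right_inv hy] at this
  have hev : ∀ᶠ s in 𝓝 t, c s ∈ e.target ∧ e.symm (c s) ∈ e'.source :=
    (hcc.eventually (e.open_target.mem_nhds ht)).and
      (((e.symm.continuousAt ht).comp hcc).eventually (e'.open_source.mem_nhds ht'))
  have h1 : ∀ᶠ s in 𝓝 t, HasDerivAt (e' ∘ (e.symm ∘ c)) (fderiv ℝ τ (c s) (c₁ s)) s := by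
    filter_upwards [hev, hc] with s hs hcs
    exact ((hτd _ hs.1 hs.2).differentiableAt (by simp)).hasFDerivAt.comp_hasDerivAt s hcs
  have h2 : DifferentiableAt ℝ (fderiv ℝ τ) (c t) :=
    ((hτd _ ht ht').fderiv_right (m := 1) (by norm_cast)).differentiableAt (by simp)
  have h3 := (h2.hasFDerivAt.comp_hasDerivAt t hc.self_of_nhds).clm_apply hc₁
  have h4 : deriv (e' ∘ (e.symm ∘ c)) =ᶠ[𝓝 t] fun s ↦ fderiv ℝ τ (c s) (c₁ s) := by
    filter_upwards [h1] with s hs using hs.deriv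
  rw [(h3.congr_of_eventuallyEq h4).deriv, h4.self_of_nhds,
    christoffel_eq he' (e'.map_source ht')]
  have h5 := christoffelMap_transition (D := D) he he' (e.map_target ht) ht' (c₁ t) (c₁ t)
  rw [e.right_inv ht, ← hτ] at h5
  have h6 : fderiv ℝ τ (c t) (c₂ + christoffelMap D e (c t) (c₁ t) (c₁ t)) = 0 := by
    rw [hgeo, map_zero]
  rw [map_add] at h6
  simp only [h5, Function.comp]
  rw [← h6]
  abel

end ChangeOfChart

/-! ### Uniqueness of geodesics and identification of `expMap`. -/

section Uniqueness

variable {n : ℕ} {M : Type*} [TopologicalSpace M] [ChartedSpace (EuclideanSpace ℝ (Fin n)) M]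
  {e : OpenPartialHomeomorph M (EuclideanSpace ℝ (Fin n))}

/-- The second order system of the geodesic equation has locally unique solutions. -/
theorem geodesic_eventuallyEq {E : Type*} [NormedAddCommGroup E] [NormedSpace ℝ E]
    {Γ : E → E →L[ℝ] E →L[ℝ] E} {c d : ℝ → E} {t : ℝ} (hΓ : ContDiffAt ℝ 1 Γ (c t))
    (hc : ContDiffAt ℝ ∞ c t) (hd : ContDiffAt ℝ ∞ d t)
    (hcg : ∀ᶠ s in 𝓝 t, deriv (deriv c) s + Γ (c s) (deriv c s) (deriv c s) = 0)
    (hdg : ∀ᶠ s in 𝓝 t, deriv (deriv d) s + Γ (d s) (deriv d s) (deriv d s) = 0)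
    (h0 : c t = d t) (h1 : deriv c t = deriv d t) : c =ᶠ[𝓝 t] d := by
  -- First-order form of the equation; V is C¹, hence locally Lipschitz, and ODE uniqueness applies.
  let V : E × E → E × E := fun z ↦ (z.2, -Γ z.1 z.2 z.2)
  have hV : ContDiffAt ℝ 1 V (c t, deriv c t) := by
    refine contDiffAt_snd.prodMk (ContDiffAt.neg ?_)
    exact ((ContDiffAt.comp (c t, deriv c t) (f := Prod.fst) hΓ contDiffAt_fst).clm_apply
      contDiffAt_snd).clm_apply contDiffAt_snd
  obtain ⟨K, s, hs, hK⟩ := hV.exists_lipschitzOnWith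
  have hsol {c : ℝ → E} (hc : ContDiffAt ℝ ∞ c t) (hs : s ∈ 𝓝 (c t, deriv c t))
      (hcg : ∀ᶠ s in 𝓝 t, deriv (deriv c) s + Γ (c s) (deriv c s) (deriv c s) = 0) :
      ∀ᶠ u in 𝓝 t, HasDerivAt (fun u ↦ (c u, deriv c u)) (V (c u, deriv c u)) u ∧
        (c u, deriv c u) ∈ s := by
    have hc2 : ContDiffAt ℝ 2 c t := hc.of_le ENat.LEInfty.out
    have hc1 : ContDiffAt ℝ 1 (deriv c) t := by
      have h : ContDiffAt ℝ 1 (fun u ↦ fderiv ℝ c u 1) t :=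
        (hc2.fderiv_right (m := 1) (by norm_num)).clm_apply contDiffAt_const
      simpa only [fderiv_apply_one_eq_deriv] using! h
    have hcont : ContinuousAt (fun u ↦ (c u, deriv c u)) t :=
      hc.continuousAt.prodMk hc1.continuousAt
    filter_upwards [hcg, hc2.eventually (by simp), hc1.eventually (by simp), hcont hs]
      with u hu hu2 hu1 hus
    refine ⟨?_, hus⟩
    have e2 := (hu1.differentiableAt (by simp)).hasDerivAt
    rw [eq_neg_of_add_eq_zero_left hu] at e2
    exact (hu2.differentiableAt (by simp)).hasDerivAt.prodMk e2
  have h := ODE_solution_unique_of_eventually (v := fun _ ↦ V) (s := fun _ ↦ s) (K := K)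
    (Eventually.of_forall fun _ ↦ hK) (hsol hc hs hcg) (hsol hd (by rwa [← h0, ← h1]) hdg)
    (by rw [h0, h1])
  filter_upwards [h] with u hu using congrArg Prod.fst hu

theorem contDiffAt_chart_comp (he : e ∈ IsManifold.maximalAtlas (𝓡 n) ∞ M) {γ : ℝ → M} {t : ℝ}
    (hγ : ContMDiffAt 𝓘(ℝ, ℝ) (𝓡 n) ∞ γ t) (ht : γ t ∈ e.source) : ContDiffAt ℝ ∞ (e ∘ γ) t :=
  ((contMDiffAt_of_mem_maximalAtlas he ht).comp t hγ).contDiffAt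

theorem components_mfderiv_curve (he : e ∈ IsManifold.maximalAtlas (𝓡 n) ∞ M) {γ : ℝ → M} {t : ℝ}
    (hγ : MDifferentiableAt 𝓘(ℝ, ℝ) (𝓡 n) γ t) (ht : γ t ∈ e.source) :
    components e (γ t) (mfderiv 𝓘(ℝ, ℝ) (𝓡 n) γ t (1 : ℝ)) = deriv (e ∘ γ) t := by
  have h := mfderiv_comp t ((chart_mdifferentiable he).mdifferentiableAt ht) hγ
  rw [mfderiv_eq_fderiv] at h
  rw [← fderiv_apply_one_eq_deriv, h]
  rfl

theorem tangentMap_eq_iff (he : e ∈ IsManifold.maximalAtlas (𝓡 n) ∞ M) {γ : ℝ → M}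
    (hγ : MDifferentiableAt 𝓘(ℝ, ℝ) (𝓡 n) γ 0) {p : M} (hp : p ∈ e.source)
    (v : TangentSpace (𝓡 n) p) :
    tangentMap 𝓘(ℝ, ℝ) (𝓡 n) γ ⟨0, (1 : ℝ)⟩ = (⟨p, v⟩ : TangentBundle (𝓡 n) M)
      ↔ γ 0 = p ∧ deriv (e ∘ γ) 0 = components e p v := by
  constructor
  · intro h
    obtain rfl : γ 0 = p := congrArg Bundle.TotalSpace.proj h
    refine ⟨rfl, ?_⟩
    have h' : mfderiv 𝓘(ℝ, ℝ) (𝓡 n) γ 0 (1 : ℝ) = v := by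
      simpa only [tangentMap, Bundle.TotalSpace.mk_inj] using! h
    rw [← components_mfderiv_curve he hγ hp, h']
  · rintro ⟨rfl, h⟩
    rw [← components_mfderiv_curve he hγ hp] at h
    have h' : mfderiv 𝓘(ℝ, ℝ) (𝓡 n) γ 0 (1 : ℝ) = v := by
      rw [← coordField_components he hp v, ← h, coordField_components he hp]
    rw [← h']
    rfl

variable [IsManifold (𝓡 n) ∞ M] {D : AffineConnection n M}

/-- Geodesics with the same initial condition agree as long as one of them stays in the domain of
a chart. -/
theorem IsGeodesicOn.eqOn_Icc [T2Space M] (he : e ∈ IsManifold.maximalAtlas (𝓡 n) ∞ M)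
    (hΓ : AnalyticOnNhd ℝ (christoffelMap D e) e.target) {γ δ : ℝ → M} {J : Set ℝ}
    (hJ : IsOpen J) (hJ01 : Icc (0 : ℝ) 1 ⊆ J) (hγ : IsGeodesicOn D γ J) (hδ : IsGeodesicOn D δ J)
    (hγe : ∀ t ∈ Icc (0 : ℝ) 1, γ t ∈ e.source) (h0 : γ 0 = δ 0)
    (h1 : deriv (e ∘ γ) 0 = deriv (e ∘ δ) 0) : EqOn γ δ (Icc 0 1) := by
  have hsm {γ : ℝ → M} (hγ : IsGeodesicOn D γ J) (t : ℝ) (ht : t ∈ Icc (0 : ℝ) 1) :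
      ContMDiffAt 𝓘(ℝ, ℝ) (𝓡 n) ∞ γ t :=
    (hγ.smooth t (hJ01 ht)).contMDiffAt (hJ.mem_nhds (hJ01 ht))
  have heq {γ : ℝ → M} (hγ : IsGeodesicOn D γ J) (t : ℝ) (ht : t ∈ Icc (0 : ℝ) 1)
      (hte : γ t ∈ e.source) : ∀ᶠ s in 𝓝 t, γ s ∈ e.source ∧
        deriv (deriv (e ∘ γ)) s
          + christoffelMap D e ((e ∘ γ) s) (deriv (e ∘ γ) s) (deriv (e ∘ γ) s) = 0 := by
    filter_upwards [hJ.mem_nhds (hJ01 ht),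
      (hsm hγ t ht).continuousAt (e.open_source.mem_nhds hte)] with s hs hse
    refine ⟨hse, ?_⟩
    rw [Function.comp_apply, ← christoffel_eq he (e.map_source hse)]
    exact hγ.equation e he s hs hse
  have hloc (t : ℝ) (ht : t ∈ Icc (0 : ℝ) 1) (h0 : γ t = δ t)
      (h1 : deriv (e ∘ γ) t = deriv (e ∘ δ) t) : ∀ᶠ s in 𝓝 t, γ s = δ s := by
    have hte := hγe t ht
    have hte' := h0 ▸ hte
    have h2 := geodesic_eventuallyEq (Γ := christoffelMap D e)
      (hΓ _ (e.map_source hte)).contDiffAt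
      (contDiffAt_chart_comp he (hsm hγ t ht) hte) (contDiffAt_chart_comp he (hsm hδ t ht) hte')
      ((heq hγ t ht hte).mono fun _ h ↦ h.2) ((heq hδ t ht hte').mono fun _ h ↦ h.2)
      (by simp [h0]) h1
    filter_upwards [h2, heq hγ t ht hte, heq hδ t ht hte'] with s hs hs1 hs2
    exact e.injOn hs1.1 hs2.1 hs
  -- Agreement near t, rather than at t, makes u open and forces velocities to agree too. At a limit
  -- point, positions agree because M is Hausdorff; this puts δ t in the chart, where velocities
  -- agree by continuity, and `hloc` applies.
  let u : Set ℝ := {t | ∀ᶠ s in 𝓝 t, γ s = δ s}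
  have hu : IsOpen u := isOpen_setOfPred_eventually_nhds
  have hsub : Icc (0 : ℝ) 1 ⊆ u := by
    refine isPreconnected_Icc.subset_of_closure_inter_subset hu
      ⟨0, by norm_num, hloc 0 (by norm_num) h0 h1⟩ ?_
    rintro t ⟨htc, ht⟩
    have hfr : ∃ᶠ s in 𝓝 t, s ∈ u := mem_closure_iff_frequently.1 htc
    have h0t : γ t = δ t :=
      tendsto_nhds_unique_of_frequently_eq (hsm hγ t ht).continuousAt (hsm hδ t ht).continuousAt
        (hfr.mono fun s hs ↦ hs.self_of_nhds)
    have hte := hγe t ht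
    have hdc {γ : ℝ → M} (hγ : IsGeodesicOn D γ J) (hte : γ t ∈ e.source) :
        ContinuousAt (deriv (e ∘ γ)) t := by
      have h := (contDiffAt_chart_comp he (hsm hγ t ht) hte).fderiv_right (m := 0) (by simp)
      have h' := h.continuousAt.clm_apply (continuousAt_const (y := (1 : ℝ)))
      simpa only [fderiv_apply_one_eq_deriv] using! h'
    refine hloc t ht h0t (tendsto_nhds_unique_of_frequently_eq (hdc hγ hte)
      (hdc hδ (h0t ▸ hte)) (hfr.mono fun s hs ↦ ?_))
    exact Filter.EventuallyEq.deriv_eq (hs.mono fun r hr ↦ by simp [hr])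
  exact fun t ht ↦ (hsub ht).self_of_nhds

/-- A solution of the geodesic equation in the chart `e` computes the exponential map. -/
theorem expMap_eq [T2Space M] (he : e ∈ IsManifold.maximalAtlas (𝓡 n) ∞ M)
    (hΓ : AnalyticOnNhd ℝ (christoffelMap D e) e.target) {p : M} (hp : p ∈ e.source)
    (v : TangentSpace (𝓡 n) p) {c : ℝ → EuclideanSpace ℝ (Fin n)}
    (hc : ContDiffOn ℝ ∞ c (Ioo (-2 : ℝ) 2)) (hce : ∀ t ∈ Ioo (-2 : ℝ) 2, c t ∈ e.target)
    (hgeo : ∀ t ∈ Ioo (-2 : ℝ) 2,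
      deriv (deriv c) t + christoffelMap D e (c t) (deriv c t) (deriv c t) = 0)
    (hc0 : c 0 = e p) (hc1 : deriv c 0 = components e p v) :
    v ∈ expDomain D p ∧ expMap D p v = e.symm (c 1) := by
  have hJ : IsOpen (Ioo (-2 : ℝ) 2) := isOpen_Ioo
  have hcat (t : ℝ) (ht : t ∈ Ioo (-2 : ℝ) 2) : ContDiffAt ℝ ∞ c t := hc.contDiffAt (hJ.mem_nhds ht)
  have hγs (t : ℝ) (ht : t ∈ Ioo (-2 : ℝ) 2) : ContMDiffAt 𝓘(ℝ, ℝ) (𝓡 n) ∞ (e.symm ∘ c) t :=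
    (contMDiffAt_symm_of_mem_maximalAtlas he (hce t ht)).comp t (hcat t ht).contMDiffAt
  have hγ : IsGeodesicOn D (e.symm ∘ c) (Ioo (-2 : ℝ) 2) := by
    refine ⟨fun t ht ↦ (hγs t ht).contMDiffWithinAt, fun e' he' t ht ht' ↦ ?_⟩
    have hd : ∀ᶠ s in 𝓝 t, HasDerivAt c (deriv c s) s := by
      filter_upwards [hJ.mem_nhds ht] with s hs
      exact ((hcat s hs).differentiableAt (by simp)).hasDerivAt
    have hd1 : HasDerivAt (deriv c) (deriv (deriv c) t) t := by
      have h : ContDiffAt ℝ 1 (fun u ↦ fderiv ℝ c u 1) t :=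
        ((hcat t ht).fderiv_right (m := 1) (by norm_cast)).clm_apply contDiffAt_const
      have h' : DifferentiableAt ℝ (deriv c) t := by
        simpa only [fderiv_apply_one_eq_deriv] using! h.differentiableAt (by simp)
      exact h'.hasDerivAt
    exact geodesic_equation_transition he he' (hce t ht) ht' hd hd1 (hgeo t ht)
  have h00 : (0 : ℝ) ∈ Ioo (-2 : ℝ) 2 := by norm_num
  have hec : e ∘ (e.symm ∘ c) =ᶠ[𝓝 0] c := by
    filter_upwards [hJ.mem_nhds h00] with s hs
    simp [e.right_inv (hce s hs)]
  have hd0 : deriv (e ∘ (e.symm ∘ c)) 0 = components e p v := by rw [hec.deriv_eq, hc1]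
  have hγ0 : (e.symm ∘ c) 0 = p := by simp [hc0, e.left_inv hp]
  have hfrom : IsGeodesicFrom D p v (e.symm ∘ c) := by
    refine ⟨⟨1, one_pos, ⟨hγ.smooth.mono (Ioo_subset_Ioo (by norm_num) (by norm_num)),
      fun e' he' t ht ↦ hγ.equation e' he' t (Ioo_subset_Ioo (by norm_num) (by norm_num) ht)⟩⟩, ?_⟩
    exact (tangentMap_eq_iff he ((hγs 0 h00).mdifferentiableAt (by simp)) hp v).2 ⟨hγ0, hd0⟩
  have hex : ∃ γ : ℝ → M, IsGeodesicFrom D p v γ := ⟨_, hfrom⟩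
  refine ⟨hex, ?_⟩
  rw [expMap, dif_pos hex]
  -- `expMap` uses a chosen geodesic about which only its initial data are known. Uniqueness on a
  -- common interval, hence `min ε 1`, fixes its value at time 1.
  obtain ⟨⟨ε, hε, hδ⟩, hδ0⟩ := hex.choose_spec
  set δ := hex.choose
  have hε' : 0 < min ε 1 := lt_min hε one_pos
  have hsub1 : Ioo (-min ε 1) (1 + min ε 1) ⊆ Ioo (-ε) (1 + ε) :=
    Ioo_subset_Ioo (neg_le_neg (min_le_left _ _)) (by gcongr; exact min_le_left _ _)
  have hsub2 : Ioo (-min ε 1) (1 + min ε 1) ⊆ Ioo (-2 : ℝ) 2 :=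
    Ioo_subset_Ioo (by linarith [min_le_right ε 1]) (by linarith [min_le_right ε 1])
  have hδs : MDifferentiableAt 𝓘(ℝ, ℝ) (𝓡 n) δ 0 :=
    ((hδ.smooth 0 ⟨by linarith, by linarith⟩).contMDiffAt
      (isOpen_Ioo.mem_nhds ⟨by linarith, by linarith⟩)).mdifferentiableAt (by simp)
  obtain ⟨hδp, hδv⟩ := (tangentMap_eq_iff he hδs hp v).1 hδ0
  have := IsGeodesicOn.eqOn_Icc he hΓ isOpen_Ioo
    (fun t ht ↦ ⟨by linarith [ht.1], by linarith [ht.2]⟩)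
    (⟨hγ.smooth.mono hsub2, fun e' he' t ht ↦ hγ.equation e' he' t (hsub2 ht)⟩ :
      IsGeodesicOn D (e.symm ∘ c) (Ioo (-min ε 1) (1 + min ε 1)))
    ⟨hδ.smooth.mono hsub1, fun e' he' t ht ↦ hδ.equation e' he' t (hsub1 ht)⟩
    (fun t ht ↦ e.map_target (hce t ⟨by linarith [ht.1], by linarith [ht.2]⟩))
    (hγ0.trans hδp.symm) (hd0.trans hδv.symm)
  exact (this (show (1 : ℝ) ∈ Icc (0 : ℝ) 1 by norm_num)).symm

end Uniqueness

/-! ### The exponential map in a chart and its local inverse. -/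

/-- The rays of an exponential map satisfy the geodesic equation. -/
theorem ray_properties {E : Type*} [NormedAddCommGroup E] [NormedSpace ℝ E] [CompleteSpace E]
    {Γ : E → E →L[ℝ] E →L[ℝ] E} {f : E → E} {ρ : ℝ}
    (hf : AnalyticOnNhd ℝ f (Metric.ball 0 (2 * ρ)))
    (hgeo : ∀ v ∈ Metric.ball (0 : E) ρ, ∀ t ∈ Ioo (-2 : ℝ) 2,
        fderiv ℝ (fderiv ℝ f) (t • v) v v
          + Γ (f (t • v)) (fderiv ℝ f (t • v) v) (fderiv ℝ f (t • v) v) = 0)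
    {a : E} (ha : a ∈ Metric.ball (0 : E) ρ) :
    ContDiffOn ℝ ∞ (fun t : ℝ ↦ f (t • a)) (Ioo (-2 : ℝ) 2) ∧
    (∀ t ∈ Ioo (-2 : ℝ) 2, deriv (deriv fun t : ℝ ↦ f (t • a)) t
      + Γ (f (t • a)) (deriv (fun t : ℝ ↦ f (t • a)) t) (deriv (fun t : ℝ ↦ f (t • a)) t) = 0) ∧
    deriv (fun t : ℝ ↦ f (t • a)) 0 = fderiv ℝ f 0 a := by
  have hline (t : ℝ) : HasDerivAt (fun s : ℝ ↦ s • a) a t := by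
    simpa using (hasDerivAt_id t).smul_const a
  have hd1 (t : ℝ) (ht : t ∈ Ioo (-2 : ℝ) 2) :
      HasDerivAt (fun t : ℝ ↦ f (t • a)) (fderiv ℝ f (t • a) a) t := by
    have hmem := smul_mem_ball_two_mul ha ht
    have hf0 := hf _ hmem
    exact hf0.differentiableAt.hasFDerivAt.comp_hasDerivAt t (hline t)
  have hd2 (t : ℝ) (ht : t ∈ Ioo (-2 : ℝ) 2) :
      HasDerivAt (deriv fun t : ℝ ↦ f (t • a)) (fderiv ℝ (fderiv ℝ f) (t • a) a a) t := by
    have hmem := smul_mem_ball_two_mul ha ht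
    have hf1 := (hf _ hmem).fderiv
    have hc1 := hf1.differentiableAt.hasFDerivAt.comp_hasDerivAt t (hline t)
    have h1 : HasDerivAt (fun t : ℝ ↦ fderiv ℝ f (t • a) a)
        (fderiv ℝ (fderiv ℝ f) (t • a) a a) t := by
      simpa using! hc1.clm_apply (hasDerivAt_const t a)
    refine h1.congr_of_eventuallyEq ?_
    filter_upwards [isOpen_Ioo.mem_nhds ht] with s hs using (hd1 s hs).deriv
  refine ⟨fun t ht ↦ ?_, fun t ht ↦ ?_, ?_⟩
  · exact ((hf _ (smul_mem_ball_two_mul ha ht)).contDiffAt.comp t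
      (contDiffAt_id.smul contDiffAt_const)).contDiffWithinAt
  · rw [(hd2 t ht).deriv, (hd1 t ht).deriv]
    exact hgeo a ha t ht
  · rw [(hd1 0 (by norm_num)).deriv, zero_smul]

section Exponential

variable {M : Type*} [TopologicalSpace M] [ChartedSpace Plane M] [IsManifold (𝓡 2) ∞ M]
  {e : OpenPartialHomeomorph M Plane} {D : AffineConnection 2 M}
  {Ω : Π x : M, TangentSpace (𝓡 2) x →L[ℝ] TangentSpace (𝓡 2) x →L[ℝ] ℝ}

/-- The exponential map in an analytic chart: it is analytic with values in the chart, it computes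
`expMap`, and it pulls the symplectic form back to an even form. -/
theorem IsPreferred.exists_exp_in_chart [T2Space M] (hΩ : IsSymplecticForm Ω)
    (hD : IsPreferred Ω D) (he : e ∈ IsManifold.maximalAtlas (𝓡 2) ∞ M)
    (hΓ : AnalyticOnNhd ℝ (christoffelMap D e) e.target) {p : M} (hp : p ∈ e.source) :
    ∃ f : Plane → Plane, ∃ ρ > 0, AnalyticOnNhd ℝ f (Metric.ball 0 ρ) ∧ f 0 = e p ∧
      fderiv ℝ f 0 = ContinuousLinearMap.id ℝ Plane ∧
      MapsTo f (Metric.ball 0 ρ) e.target ∧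
      (∀ v : TangentSpace (𝓡 2) p, components e p v ∈ Metric.ball (0 : Plane) ρ →
        v ∈ expDomain D p ∧ expMap D p v = e.symm (f (components e p v))) ∧
      ∀ v ∈ Metric.ball (0 : Plane) ρ, ∀ a b,
        formMap Ω e (f (-v)) (fderiv ℝ f (-v) a) (fderiv ℝ f (-v) b) =
          formMap Ω e (f v) (fderiv ℝ f v a) (fderiv ℝ f v b) := by
  obtain ⟨f, ρ₀, hρ₀, hf, hf0, hf1, hgeo⟩ := exists_analytic_exp (hΓ _ (e.map_source hp))
  have hcont : ContinuousAt f 0 := (hf 0 (Metric.mem_ball_self (by positivity))).continuousAt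
  obtain ⟨ρ₁, hρ₁, hmaps⟩ := Metric.eventually_nhds_iff_ball.1
    (hcont.eventually (by rw [hf0]; exact e.open_target.mem_nhds (e.map_source hp)))
  -- The half keeps the ball of radius 2ρ, which contains t v for |t| < 2, inside the preimage of
  -- the chart target.
  set ρ := min ρ₀ (ρ₁ / 2)
  have hρ : 0 < ρ := lt_min hρ₀ (by positivity)
  have hρρ : 2 * ρ ≤ 2 * ρ₀ := by linarith [min_le_left ρ₀ (ρ₁ / 2)]
  have hf' : AnalyticOnNhd ℝ f (Metric.ball 0 (2 * ρ)) := hf.mono (Metric.ball_subset_ball hρρ)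
  have hm : MapsTo f (Metric.ball 0 (2 * ρ)) e.target := fun v hv ↦
    hmaps v (Metric.ball_subset_ball (by linarith [min_le_right ρ₀ (ρ₁ / 2)]) hv)
  have hgeo' : ∀ v ∈ Metric.ball (0 : Plane) ρ, ∀ t ∈ Ioo (-2 : ℝ) 2,
      fderiv ℝ (fderiv ℝ f) (t • v) v v + christoffelMap D e (f (t • v))
        (fderiv ℝ f (t • v) v) (fderiv ℝ f (t • v) v) = 0 :=
    fun v hv ↦ hgeo v (Metric.ball_subset_ball (min_le_left _ _) hv)
  have hsub : Metric.ball (0 : Plane) ρ ⊆ Metric.ball 0 (2 * ρ) :=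
    Metric.ball_subset_ball (by linarith)
  refine ⟨f, ρ, hρ, hf'.mono hsub, hf0, hf1, hm.mono_left hsub, fun v hv ↦ ?_, fun v hv a b ↦ ?_⟩
  · obtain ⟨h1, h2, h3⟩ := ray_properties hf' hgeo' hv
    have h := expMap_eq (c := fun t : ℝ ↦ f (t • components e p v)) he hΓ hp v h1
      (fun t ht ↦ hm (smul_mem_ball_two_mul hv ht)) h2 (by simp [hf0])
      (h3.trans (by rw [hf1]; rfl))
    simpa only [one_smul] using h
  · exact even_pullback_of_cyclic hm e.open_target hΓ
      (fun y hy ↦ christoffelMap_symm he hD.torsionFree hy)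
      (fun y hy ↦ differentiableAt_formMap hΩ he hy)
      (fun y hy u ↦ by simp [formMap, areaForm_apply, mul_comm])
      (fun y hy ↦ formMap_parallel hΩ hD.toIsSymplecticConnection he hy)
      (fun y hy ↦ hD.cyclic_coordinates he hΓ hy) hf' hgeo' hv a b

/-- Inverse function theorem for analytic maps on a symmetric neighbourhood of `0`. -/
theorem exists_localInverse_on_ball {E : Type*} [NormedAddCommGroup E] [NormedSpace ℝ E]
    [CompleteSpace E] {g : E → E} {A : E ≃L[ℝ] E} (hg : AnalyticAt ℝ g 0)
    (hA : HasFDerivAt g (A : E →L[ℝ] E) 0) {S : Set E} (hS : S ∈ 𝓝 (0 : E)) :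
    ∃ r > 0, ∃ H : OpenPartialHomeomorph E E, (H : E → E) = g ∧ H.source = Metric.ball 0 r ∧
      Metric.ball 0 r ⊆ S ∧ (∀ v ∈ H.source, AnalyticAt ℝ g v) ∧
      ∀ y ∈ H.target, AnalyticAt ℝ H.symm y := by
  have hc : ContDiffAt ℝ ω g 0 := hg.contDiffAt
  let H := hc.toOpenPartialHomeomorph g hA (by simp)
  have hHcoe : (H : E → E) = g := hc.toOpenPartialHomeomorph_coe hA (by simp)
  have hHs : (0 : E) ∈ H.source := hc.mem_toOpenPartialHomeomorph_source hA (by simp)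
  have hHt : g 0 ∈ H.target := hHcoe ▸ H.map_source hHs
  have hs0 : H.symm (g 0) = 0 := hHcoe ▸ H.left_inv hHs
  have hsymm : AnalyticAt ℝ H.symm (g 0) :=
    H.analyticAt_symm (i := A) hHt (by rw [hs0, hHcoe]; exact hg)
      (by rw [hs0, hHcoe]; exact hA.fderiv)
  -- Analyticity of the inverse is required at g v for every v of the ball. Taking a ball as source
  -- makes it star-shaped and symmetric.
  have hev : ∀ᶠ v in 𝓝 (0 : E), v ∈ H.source ∧ v ∈ S ∧ AnalyticAt ℝ g v ∧
      AnalyticAt ℝ H.symm (g v) :=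
    Filter.Eventually.and (H.open_source.mem_nhds hHs) (Filter.Eventually.and hS
      (hg.eventually_analyticAt.and (hg.continuousAt.eventually hsymm.eventually_analyticAt)))
  obtain ⟨r, hr, hball⟩ := Metric.eventually_nhds_iff_ball.1 hev
  have hsrc : (H.restrOpen (Metric.ball 0 r) Metric.isOpen_ball).source = Metric.ball 0 r := by
    rw [OpenPartialHomeomorph.restrOpen_source]
    exact inter_eq_right.2 fun v hv ↦ (hball v hv).1
  refine ⟨r, hr, H.restrOpen (Metric.ball 0 r) Metric.isOpen_ball, ?_, hsrc,
    fun v hv ↦ (hball v hv).2.1, fun v hv ↦ (hball v (hsrc ▸ hv)).2.2.1, fun y hy ↦ ?_⟩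
  · simp [hHcoe]
  · set H' := H.restrOpen (Metric.ball 0 r) Metric.isOpen_ball with hH'
    have h1 := H'.map_target hy
    rw [hsrc] at h1
    have h2 := (hball _ h1).2.2.2
    have h3 : g (H'.symm y) = y := by
      have := H'.right_inv hy
      rwa [show (H' : E → E) = g by simp [hH', hHcoe]] at this
    rw [h3] at h2
    simpa [hH'] using h2

end Exponential

/-! ### The geodesic symmetry and its effect on the symplectic form. -/

theorem hasFDerivAt_reflection {E : Type*} [NormedAddCommGroup E] [NormedSpace ℝ E]
    {H : OpenPartialHomeomorph E E} (hH : ∀ v ∈ H.source, DifferentiableAt ℝ H v)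
    (hHs : ∀ y ∈ H.target, DifferentiableAt ℝ H.symm y) {y : E} (hy : y ∈ H.target)
    (hneg : -H.symm y ∈ H.source) :
    (∀ u, fderiv ℝ H (H.symm y) (fderiv ℝ H.symm y u) = u) ∧
      HasFDerivAt (fun z ↦ H (-H.symm z))
        ((fderiv ℝ H (-H.symm y)).comp (-fderiv ℝ H.symm y)) y := by
  refine ⟨fun u ↦ ?_, ?_⟩
  · have h1 := (hH _ (H.map_target hy)).hasFDerivAt.comp y (hHs y hy).hasFDerivAt
    have h2 : (H ∘ H.symm) =ᶠ[𝓝 y] id := by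
      filter_upwards [H.open_target.mem_nhds hy] with z hz using H.right_inv hz
    exact congrArg (fun L ↦ L u) (h1.unique ((hasFDerivAt_id y).congr_of_eventuallyEq h2))
  · exact (hH _ hneg).hasFDerivAt.comp y (hHs y hy).hasFDerivAt.neg

/-- Near x, e ∘ s = k ∘ e; the chain rule then transfers the differential of s to that of k. -/
theorem components_mfderiv_conj {n : ℕ} {M : Type*} [TopologicalSpace M]
    [ChartedSpace (EuclideanSpace ℝ (Fin n)) M] [IsManifold (𝓡 n) ∞ M]
    {e : OpenPartialHomeomorph M (EuclideanSpace ℝ (Fin n))}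
    (he : e ∈ IsManifold.maximalAtlas (𝓡 n) ∞ M)
    {k : EuclideanSpace ℝ (Fin n) → EuclideanSpace ℝ (Fin n)} {s : M → M} {x : M}
    {k' : EuclideanSpace ℝ (Fin n) →L[ℝ] EuclideanSpace ℝ (Fin n)}
    (hx : x ∈ e.source) (hs : s =ᶠ[𝓝 x] fun y ↦ e.symm (k (e y)))
    (hk : HasFDerivAt k k' (e x)) (hkt : k (e x) ∈ e.target)
    (u : TangentSpace (𝓡 n) x) :
    components e (s x) (mfderiv (𝓡 n) (𝓡 n) s x u) = k' (components e x u) := by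
  have hm := chart_mdifferentiable he
  have hke : HasMFDerivAt (𝓡 n) (𝓡 n) (k ∘ e) x
      (ContinuousLinearMap.comp (M₁ := TangentSpace (𝓡 n) x) k' (mfderiv (𝓡 n) (𝓡 n) e x)) :=
    hk.hasMFDerivAt.comp x (hm.mdifferentiableAt hx).hasMFDerivAt
  have hsx : s x = e.symm (k (e x)) := hs.self_of_nhds
  have hsd : MDifferentiableAt (𝓡 n) (𝓡 n) s x := by
    refine MDifferentiableAt.congr_of_eventuallyEq ?_ hs
    exact (hm.mdifferentiableAt_symm hkt).comp x hke.mdifferentiableAt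
  have hsmem : s x ∈ e.source := hsx ▸ e.map_target hkt
  have hes : (e ∘ s) =ᶠ[𝓝 x] k ∘ e := by
    have h : ∀ᶠ y in 𝓝 x, k (e y) ∈ e.target :=
      hke.continuousAt.eventually (e.open_target.mem_nhds hkt)
    filter_upwards [hs, h] with y hy hyt
    simp only [Function.comp_apply, hy, e.right_inv hyt]
  have h1 := ((hm.mdifferentiableAt hsmem).hasMFDerivAt.comp x hsd.hasMFDerivAt)
  have h2 := hasMFDerivAt_unique (h1.congr_of_eventuallyEq hes.symm) hke
  exact congrArg (fun L ↦ L u) h2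

variable {M : Type*} [TopologicalSpace M] [ChartedSpace Plane M] [IsManifold (𝓡 2) ∞ M]
  {e : OpenPartialHomeomorph M Plane}

/-- A local inverse of the exponential map in a chart gives a local diffeomorphism to the
manifold. -/
def chartDiffeomorph (he : e ∈ IsManifold.maximalAtlas (𝓡 2) ∞ M)
    (H : OpenPartialHomeomorph Plane Plane) (hH : ∀ v ∈ H.source, AnalyticAt ℝ H v)
    (hHs : ∀ y ∈ H.target, AnalyticAt ℝ H.symm y) :
    PartialDiffeomorph 𝓘(ℝ, Plane) (𝓡 2) Plane M ∞ where
  toPartialEquiv := (H.trans e.symm).toPartialEquiv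
  open_source := (H.trans e.symm).open_source
  open_target := (H.trans e.symm).open_target
  contMDiffOn_toFun := fun v hv ↦
    ((contMDiffAt_symm_of_mem_maximalAtlas he hv.2).comp v
      (hH v hv.1).contDiffAt.contMDiffAt).contMDiffWithinAt
  contMDiffOn_invFun := fun x hx ↦
    (((hHs (e x) hx.2).contDiffAt.contMDiffAt).comp x
      (contMDiffAt_of_mem_maximalAtlas he hx.1)).contMDiffWithinAt

variable {D : AffineConnection 2 M}
  {Ω : Π x : M, TangentSpace (𝓡 2) x →L[ℝ] TangentSpace (𝓡 2) x →L[ℝ] ℝ}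

/-- The geodesic symmetry preserves the form if the exponential map, read in a chart, pulls it
back to an even form. -/
theorem geodesicSymmetry_symplectic (hΩ : IsSymplecticForm Ω)
    (he : e ∈ IsManifold.maximalAtlas (𝓡 2) ∞ M)
    {H : OpenPartialHomeomorph Plane Plane} (hH : ∀ v ∈ H.source, AnalyticAt ℝ H v)
    (hHs : ∀ y ∈ H.target, AnalyticAt ℝ H.symm y) (hneg : ∀ v ∈ H.source, -v ∈ H.source)
    (hmaps : MapsTo H H.source e.target)
    (heven : ∀ v ∈ H.source, ∀ a b,
      formMap Ω e (H (-v)) (fderiv ℝ H (-v) a) (fderiv ℝ H (-v) b) =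
        formMap Ω e (H v) (fderiv ℝ H v a) (fderiv ℝ H v b))
    {x : M} (hx : x ∈ (chartDiffeomorph he H hH hHs).target) (u v : TangentSpace (𝓡 2) x) :
    Ω (geodesicSymmetry (chartDiffeomorph he H hH hHs) x)
        (mfderiv (𝓡 2) (𝓡 2) (geodesicSymmetry (chartDiffeomorph he H hH hHs)) x u)
        (mfderiv (𝓡 2) (𝓡 2) (geodesicSymmetry (chartDiffeomorph he H hH hHs)) x v) =
      Ω x u v := by
  have hxe : x ∈ e.source := hx.1
  have hxH : e x ∈ H.target := hx.2
  have hw := H.map_target hxH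
  have hnw := hneg _ hw
  have hkt : H (-H.symm (e x)) ∈ e.target := hmaps hnw
  obtain ⟨hid, hder⟩ := hasFDerivAt_reflection (fun v hv ↦ (hH v hv).differentiableAt)
    (fun y hy ↦ (hHs y hy).differentiableAt) hxH hnw
  have hs : geodesicSymmetry (chartDiffeomorph he H hH hHs) =
      fun y ↦ e.symm (H (-H.symm (e y))) := rfl
  have hcomp (w : TangentSpace (𝓡 2) x) := components_mfderiv_conj he hxe hs.eventuallyEq hder hkt w
  have hsx : geodesicSymmetry (chartDiffeomorph he H hH hHs) x ∈ e.source := e.map_target hkt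
  have hesx : e (geodesicSymmetry (chartDiffeomorph he H hH hHs) x) = H (-H.symm (e x)) :=
    e.right_inv hkt
  rw [← formMap_components hΩ he hsx, ← formMap_components hΩ he hxe, hcomp, hcomp, hesx]
  -- The differential of the symmetry is DH(-w) ∘ (-DH⁻¹). On the other side DH(w) undoes DH⁻¹, and
  -- the two signs cancel by bilinearity.
  have h := heven _ hw (-fderiv ℝ H.symm (e x) (components e x u))
    (-fderiv ℝ H.symm (e x) (components e x v))
  rw [map_neg (fderiv ℝ H (H.symm (e x))), map_neg (fderiv ℝ H (H.symm (e x))), hid, hid,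
    H.right_inv hxH] at h
  refine Eq.trans h ?_
  simp

theorem IsPreferred.exists_symmetricNormal [T2Space M] (hΩ : IsSymplecticForm Ω)
    (hD : IsPreferred Ω D) (he : e ∈ IsManifold.maximalAtlas (𝓡 2) ∞ M)
    (hΓ : AnalyticOnNhd ℝ (christoffelMap D e) e.target) {p : M} (hp : p ∈ e.source) :
    ∃ Φ : PartialDiffeomorph 𝓘(ℝ, Plane) (𝓡 2) Plane M ∞,
      IsSymmetricNormal D p Φ ∧ ∀ x ∈ Φ.target, ∀ u v : TangentSpace (𝓡 2) x,
        Ω (geodesicSymmetry Φ x) (mfderiv (𝓡 2) (𝓡 2) (geodesicSymmetry Φ) x u)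
          (mfderiv (𝓡 2) (𝓡 2) (geodesicSymmetry Φ) x v) = Ω x u v := by
  obtain ⟨f, ρ, hρ, hf, hf0, hf1, hmaps, hexp, heven⟩ := hD.exists_exp_in_chart hΩ he hΓ hp
  -- f takes components in the analytic chart e, whereas `TangentSpace` at p is the model plane with
  -- its own identification; A = de_p converts between them, so the exponential map reads f ∘ A in
  -- e.
  obtain ⟨A, hA⟩ : ∃ A : Plane ≃L[ℝ] Plane, ∀ v, A v = components e p v :=
    ⟨(chart_mdifferentiable he).mfderiv hp, fun _ ↦ rfl⟩
  have h0 : (0 : Plane) ∈ Metric.ball (0 : Plane) ρ := Metric.mem_ball_self hρ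
  have hg : AnalyticAt ℝ (fun v ↦ f (A v)) 0 :=
    AnalyticAt.comp_of_eq (hf 0 h0) ((A : Plane →L[ℝ] Plane).analyticAt 0) (map_zero A)
  have hgd (v : Plane) (hv : A v ∈ Metric.ball (0 : Plane) ρ) :
      HasFDerivAt (fun v ↦ f (A v)) ((fderiv ℝ f (A v)).comp (A : Plane →L[ℝ] Plane)) v :=
    (hf _ hv).differentiableAt.hasFDerivAt.comp v A.hasFDerivAt
  have hg1 : HasFDerivAt (fun v ↦ f (A v)) (A : Plane →L[ℝ] Plane) 0 := by
    have h := hgd 0 (by rwa [map_zero])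
    rwa [map_zero, hf1, ContinuousLinearMap.id_comp] at h
  obtain ⟨r, hr, H, hHg, hsrc, hS, hH, hHs⟩ := exists_localInverse_on_ball hg hg1
    (S := A ⁻¹' Metric.ball 0 ρ)
    (A.continuous.continuousAt.preimage_mem_nhds
      (by rw [map_zero]; exact Metric.ball_mem_nhds 0 hρ))
  rw [← hHg] at hH
  have hneg : ∀ v ∈ H.source, -v ∈ H.source := fun v hv ↦ by
    rw [hsrc] at hv ⊢; simpa using hv
  have hAmem : ∀ v ∈ H.source, A v ∈ Metric.ball (0 : Plane) ρ := fun v hv ↦ hS (hsrc ▸ hv)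
  have hHmaps : MapsTo H H.source e.target := fun v hv ↦ by
    rw [hHg]; exact hmaps (hAmem v hv)
  have hΦs : (chartDiffeomorph he H hH hHs).source = Metric.ball 0 r := by
    rw [← hsrc]
    exact inter_eq_left.2 hHmaps
  have hexp' (v : Plane) (hv : v ∈ (chartDiffeomorph he H hH hHs).source) :=
    hexp v (by rw [← hA]; exact hAmem v (by rwa [hsrc, ← hΦs]))
  refine ⟨chartDiffeomorph he H hH hHs, ⟨?_, ?_, fun v hv ↦ ?_, fun v hv ↦ (hexp' v hv).1,
    fun v hv ↦ ?_⟩, fun x hx u v ↦ ?_⟩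
  · rw [hΦs]; exact Metric.mem_ball_self hr
  · rw [hΦs]; exact (convex_ball 0 r).starConvex (Metric.mem_ball_self hr)
  · rw [hΦs, ← hsrc] at hv ⊢; exact hneg v hv
  · rw [(hexp' v hv).2, ← hA]
    exact congrArg e.symm (congrFun hHg v)
  · refine geodesicSymmetry_symplectic hΩ he hH hHs hneg hHmaps (fun v hv a b ↦ ?_) hx u v
    have hv' := hAmem v hv
    -- By the chain rule, A moves into the arguments a and b; linearity gives A(-v) = -A v, so
    -- evenness for f passes to f ∘ A.
    rw [hHg, (hgd v hv').fderiv, (hgd (-v) (hAmem _ (hneg v hv))).fderiv]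
    dsimp only
    rw [map_neg]
    exact heven _ hv' _ _

end Fedosov

end

theorem mainTheorem5 {M : Type*} [TopologicalSpace M] [T2Space M]
    [ChartedSpace (EuclideanSpace ℝ (Fin 2)) M] [IsManifold (𝓡 2) ∞ M]
    (Ω : Π x : M, TangentSpace (𝓡 2) x →L[ℝ] TangentSpace (𝓡 2) x →L[ℝ] ℝ)
    (hΩ : Fedosov.IsSymplecticForm Ω)
    (D : Fedosov.AffineConnection 2 M)
    (hD : Fedosov.IsPreferred Ω D)
    (hDan : Fedosov.IsAnalyticConnection D) :
    Fedosov.IsTypeS Ω D := by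
  refine ⟨hD.torsionFree, fun p ↦ ?_⟩
  obtain ⟨e, he, hp, hΓ⟩ := hDan p
  exact hD.exists_symmetricNormal hΩ he (Fedosov.analyticOnNhd_christoffelMap hΓ) hp
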